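/- For integers $n,m\ge 1$ let $\mathrm{CM}(n,m)$ be the configuration model: a random multigraph on $[n]$ with $m$ edges, in which each of the $2m$ edge ends is assigned independently and uniformly to a vertex (loops and parallel edges allowed). Give each edge the antiferromagnetic weight $-1$, i.e. $W_{vj}=-\#\{\text{edges between }v\text{ and }j\}$, a loop being counted twice in $W_{vv}$. For $d>0$ and $h\in\mathbb R$, a vertex $v$ is $h$-stable in a configuration (partition) $\sigma\in\{-1,+1\}^n$ if $$s_\sigma(v,W)=\frac1{\sqrt d}\,\sigma_v\sum_{j}W_{vj}\sigma_j\;\ge\; h .$$ Take $m=\lfloor dn/2\rfloor$. Let $X(h,r)$ be the number of $\sigma\in\{-1,+1\}^n$ with at least $rn$ $h$-stable vertices, and let $X(z,h,r)$ be the number of those for which exactly $\lfloor zn\rfloor$ edges join vertices of different spin. With $\log 0=-\infty$, put $$w_r(x,h)=\limsup_{d\to\infty}\limsup_{n\to\infty}\frac1n\log\mathbb E\big[X(\tfrac d4+x\sqrt{\tfrac d2},\,h,r)\big],\qquad w_r(h)=\sup_{x\in\mathbb R}w_r(x,h).$$ Let $$w(h)=\sup_{x\in\mathbb R}\Big(-x^2+\log\big(1+\operatorname{erf}(x-h/\sqrt2)\big)\Big),\qquad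 \operatorname{erf}(x)=\frac{2}{\sqrt\pi}\int_0^x e^{-t^2}\,dt .$$ **Proposition.** The function $w$ has a unique root $h^*\in\mathbb R$. For every $h>h^*$ there is $r=r(h)\in(0,1)$ such that $$w_r(h)<0\qquad\text{and}\qquad \limsup_{d\to\infty}\limsup_{n\to\infty}\frac1n\log\mathbb E[X(h,r)]<0 .$$ -/

import Mathlib

open Filter

namespace StablePartitions

/-- The error function `erf x = (2 / √π) ∫₀ˣ exp (-t²) dt`. -/
noncomputable def erf (x : ℝ) : ℝ :=
  2 / Real.sqrt Real.pi * ∫ t in (0 : ℝ)..x, Real.exp (-t ^ 2)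

/-- `w(h) = sup_x (-x² + log (1 + erf (x - h/√2)))`. The function under the supremum is bounded
above by `log 2`. -/
noncomputable def w (h : ℝ) : ℝ :=
  ⨆ x : ℝ, (-x ^ 2 + Real.log (1 + erf (x - h / Real.sqrt 2)))

/-- A partition of the vertex set `{0, …, n-1}`, encoded as spins `σ ∈ {+1, -1}ⁿ`. -/
abbrev Config (n : ℕ) : Type := Fin n → ℤˣ

/-- The spin of `v` as a real number. -/
noncomputable def spin {n : ℕ} (σ : Config n) (v : Fin n) : ℝ := ((σ v : ℤ) : ℝ)

/-- The single-spin-flip stability `s_σ(v, W) = d^{-1/2} σ_v ∑_j W_{vj} σ_j`. -/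
noncomputable def stability {n : ℕ} (d : ℝ) (W : Matrix (Fin n) (Fin n) ℝ) (σ : Config n)
    (v : Fin n) : ℝ :=
  1 / Real.sqrt d * (spin σ v * ∑ j, W v j * spin σ j)

/-- The vertex `v` is `h`-stable. -/
def IsStable {n : ℕ} (d h : ℝ) (W : Matrix (Fin n) (Fin n) ℝ) (σ : Config n) (v : Fin n) : Prop :=
  h ≤ stability d W σ v

open Classical in
/-- The number of `h`-stable vertices of the configuration `σ`. -/
noncomputable def numStable {n : ℕ} (d h : ℝ) (W : Matrix (Fin n) (Fin n) ℝ) (σ : Config n) : ℕ :=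
  (Finset.univ.filter fun v => IsStable d h W σ v).card

/-- An outcome of the configuration model with `n` vertices and `m` edges: the edge `k` has the two
ends `(k, false)` and `(k, true)`, and each end is assigned to a vertex. Loops and parallel edges
are allowed. The model is the uniform distribution on this finite type, so that the ends of the
edges are assigned independently and uniformly. -/
abbrev Multigraph (n m : ℕ) : Type := Fin m × Bool → Fin n

/-- The number of half-edges at `v` whose other half is at `j`, that is the number of edges
between `v` and `j`, a loop being counted twice. -/
def adjCount {n m : ℕ} (e : Multigraph n m) (v j : Fin n) : ℕ :=
  (Finset.univ.filter fun a : Fin m × Bool => e a = v ∧ e (a.1, !a.2) = j).card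

/-- The antiferromagnetic weight matrix of a multigraph: each edge has weight `-1`. -/
def weight {n m : ℕ} (e : Multigraph n m) : Matrix (Fin n) (Fin n) ℝ :=
  fun v j => -(adjCount e v j : ℝ)

/-- The number of edges joining vertices of different spin. -/
def cutSize {n m : ℕ} (e : Multigraph n m) (σ : Config n) : ℕ :=
  (Finset.univ.filter fun k : Fin m => σ (e (k, false)) ≠ σ (e (k, true))).card

/-- The number `⌊dn/2⌋` of edges at average degree `d`. -/
noncomputable def numEdges (d : ℝ) (n : ℕ) : ℕ := ⌊d * n / 2⌋₊

open Classical in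
/-- `X(h, r)`: the number of configurations with at least `r n` vertices that are `h`-stable. -/
noncomputable def X {n m : ℕ} (d h r : ℝ) (e : Multigraph n m) : ℕ :=
  (Finset.univ.filter fun σ : Config n => r * n ≤ numStable d h (weight e) σ).card

open Classical in
/-- `X(z, h, r)`: the number of configurations with cut size `⌊z n⌋` and at least `r n` vertices
that are `h`-stable. -/
noncomputable def Xcut {n m : ℕ} (d z h r : ℝ) (e : Multigraph n m) : ℕ :=
  (Finset.univ.filter fun σ : Config n =>
    (cutSize e σ : ℤ) = ⌊z * n⌋ ∧ r * n ≤ numStable d h (weight e) σ).card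

/-- The expectation of `f` in the configuration model with `n` vertices and `m` edges. -/
noncomputable def expect (n m : ℕ) (f : Multigraph n m → ℕ) : ℝ :=
  (∑ e : Multigraph n m, (f e : ℝ)) / (Fintype.card (Multigraph n m) : ℝ)

/-- The exponential rate `(1/n) log a`, with value `-∞` at `a = 0`. -/
noncomputable def rate (n : ℕ) (a : ℝ) : EReal := ENNReal.log (ENNReal.ofReal a) / (n : EReal)

/-- `limsup_{d → ∞} limsup_{n → ∞} (1/n) log E[X(h, r)]`. -/
noncomputable def entropyTotal (r h : ℝ) : EReal :=
  limsup (fun d : ℝ =>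
    limsup (fun n : ℕ => rate n (expect n (numEdges d n) (X d h r))) atTop) atTop

/-- `w_r(x, h) = limsup_{d → ∞} limsup_{n → ∞} (1/n) log E[X(z, h, r)]`, where
`z = d/4 + x √(d/2)`. -/
noncomputable def entropyCut (r x h : ℝ) : EReal :=
  limsup (fun d : ℝ =>
    limsup (fun n : ℕ =>
      rate n (expect n (numEdges d n) (Xcut d (d / 4 + x * Real.sqrt (d / 2)) h r))) atTop) atTop

/-- The first-moment entropy density `w_r(h) = sup_x w_r(x, h)`. -/
noncomputable def entropy (r h : ℝ) : EReal := ⨆ x : ℝ, entropyCut r x h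

end StablePartitions

open Filter Topology

namespace StablePartitions

/-! ### The error function: derivative, symmetry and limits. -/

section ErrorFunction

/-! The function `w` is strictly decreasing and continuous, nonnegative at `0` and negative
somewhere, so it has exactly one root, and `w h < 0` beyond it. The rest is a first moment bound: if
`w h < 0`, then `E[X(h, r)] ≤ exp (-c n)` for some `r < 1` and `c > 0`, for all large `d` and then
all large `n` (`exists_expect_X_le`). A prescribed cut size only decreases the count, so the same
`c` serves every `x`.

Fix `σ` and the number of half-edges in each class (own spin, mate's spin); there are polynomially
many such types. Within a type the half-edges are balls thrown into boxes, and their joint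
occupancies are dominated by independent Poisson weights whose rates may be chosen freely
(`prod_pow_mul_sum_prod_occupancy_le`). With rates adapted to the type, Stirling's formula and the
sum over spin patterns lose only polynomial factors (`sum_type_le`, `exists_sum_classCard_eq_le`).
What remains is a product over vertices of `vertexFactor`: a quadratic cost for tilting the two
rates, times the tail of a difference of two Poisson variables.

As the mean degree `D` grows, the central limit theorem, uniformly in all parameters, bounds a
vertex factor by `exp (-y²) * gcdf (y + S - h/√2)` up to a small error (`exists_vertexFactor_le`).
Here `S` measures the imbalance of `σ` and has opposite signs for the two spins. For the majority
spin `S ≤ 0`, and the factor is at most `exp (w h) / 2`. The product of a majority and a minority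
factor is at most the square of this, since `gcdf` is log-concave. Pairing minority with majority
vertices bounds the whole product by nearly `(exp (w h) / 2) ^ n`, and the `2 ^ n` configurations
turn this into nearly `exp (n * w h)`. Allowing `(1 - r) n` unstable vertices costs `δ ^ (-(1 - r)
n)`, which is harmless for `r` close to `1`. -/

theorem hasDerivAt_erf (x : ℝ) :
    HasDerivAt erf (2 / Real.sqrt Real.pi * Real.exp (-x ^ 2)) x := by
  have hc : Continuous fun t : ℝ => Real.exp (-t ^ 2) := by fun_prop
  exact ((hc.integral_hasStrictDerivAt 0 x).hasDerivAt).const_mul _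

theorem continuous_erf : Continuous erf :=
  continuous_iff_continuousAt.2 fun x => (hasDerivAt_erf x).continuousAt

theorem strictMono_erf : StrictMono erf :=
  strictMono_of_deriv_pos fun x => by
    rw [(hasDerivAt_erf x).deriv]
    have := Real.pi_pos
    positivity

theorem erf_zero : erf 0 = 0 := by simp [erf]

theorem erf_neg (x : ℝ) : erf (-x) = -erf x := by
  unfold erf
  have h := intervalIntegral.integral_comp_neg (a := 0) (b := x)
    (fun t : ℝ => Real.exp (-t ^ 2))
  simp only [neg_sq, neg_zero] at h
  rw [h, intervalIntegral.integral_symm, mul_neg]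

theorem tendsto_erf_atTop : Tendsto erf atTop (𝓝 1) := by
  have hi : MeasureTheory.IntegrableOn (fun t : ℝ => Real.exp (-t ^ 2)) (Set.Ioi 0) := by
    simpa using (integrable_exp_neg_mul_sq (b := 1) one_pos).integrableOn
  have h := MeasureTheory.intervalIntegral_tendsto_integral_Ioi 0 hi tendsto_id
  have h2 := integral_gaussian_Ioi 1
  simp only [neg_mul, one_mul, div_one] at h2
  rw [h2] at h
  have h3 := h.const_mul (2 / Real.sqrt Real.pi)
  have hp : Real.sqrt Real.pi ≠ 0 := (Real.sqrt_pos.2 Real.pi_pos).ne'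
  have e : 2 / Real.sqrt Real.pi * (Real.sqrt Real.pi / 2) = 1 := by field_simp
  rw [e] at h3
  exact h3

theorem tendsto_erf_atBot : Tendsto erf atBot (𝓝 (-1)) := by
  have h := (tendsto_erf_atTop.comp tendsto_neg_atBot_atTop).neg
  refine h.congr fun x => ?_
  simp [erf_neg]

theorem erf_lt_one (x : ℝ) : erf x < 1 :=
  (strictMono_erf (lt_add_one x)).trans_le
    (strictMono_erf.monotone.ge_of_tendsto tendsto_erf_atTop _)

theorem neg_one_lt_erf (x : ℝ) : -1 < erf x := by
  have h := erf_lt_one (-x)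
  rw [erf_neg] at h
  linarith

end ErrorFunction

/-! ### Log-concavity of the Gaussian distribution function. -/

section GaussianDistributionFunction

/-- The distribution function of the centred Gaussian law of variance `1/2`. -/
noncomputable def gcdf (x : ℝ) : ℝ := (1 + erf x) / 2

theorem gcdf_pos (x : ℝ) : 0 < gcdf x := by
  have := neg_one_lt_erf x
  unfold gcdf
  linarith

theorem gcdf_lt_one (x : ℝ) : gcdf x < 1 := by
  have := erf_lt_one x
  unfold gcdf
  linarith

theorem strictMono_gcdf : StrictMono gcdf := fun x y h => by
  have := strictMono_erf h
  unfold gcdf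
  linarith

theorem hasDerivAt_gcdf (x : ℝ) :
    HasDerivAt gcdf (Real.exp (-x ^ 2) / Real.sqrt Real.pi) x := by
  have h := ((hasDerivAt_erf x).const_add 1).div_const 2
  refine h.congr_deriv ?_
  field_simp

theorem continuous_gcdf : Continuous gcdf :=
  (continuous_const.add continuous_erf).div_const 2

theorem tendsto_gcdf_atBot : Tendsto gcdf atBot (𝓝 0) := by
  have h := (tendsto_erf_atBot.const_add 1).div_const 2
  norm_num at h
  exact h

theorem tendsto_gcdf_atTop : Tendsto gcdf atTop (𝓝 1) := by
  have h := (tendsto_erf_atTop.const_add 1).div_const 2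
  norm_num at h
  exact h

theorem tendsto_exp_neg_sq_atBot : Tendsto (fun x : ℝ => Real.exp (-x ^ 2)) atBot (𝓝 0) := by
  refine Real.tendsto_exp_atBot.comp (tendsto_neg_atTop_atBot.comp ?_)
  have : (fun x : ℝ => x ^ 2) = fun x : ℝ => |x| ^ 2 := by ext x; rw [sq_abs]
  rw [this]
  exact (tendsto_pow_atTop two_ne_zero).comp tendsto_abs_atBot_atTop

/-- Mills' ratio inequality. -/
theorem neg_two_mul_gcdf_le (x : ℝ) :
    -2 * x * gcdf x ≤ Real.exp (-x ^ 2) / Real.sqrt Real.pi := by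
  have hp : 0 < Real.sqrt Real.pi := Real.sqrt_pos.2 Real.pi_pos
  rcases le_or_gt 0 x with hx | hx
  · have h1 := gcdf_pos x
    have h2 : 0 ≤ Real.exp (-x ^ 2) / Real.sqrt Real.pi := by positivity
    nlinarith
  -- With `x` frozen in the denominator, the derivative is the density times `1 - y / x`, which is
  -- nonpositive for `y ≤ x < 0`. Since `F` vanishes at `-∞`, it is nonpositive at `x`.
  let F : ℝ → ℝ := fun y => gcdf y - Real.exp (-y ^ 2) / Real.sqrt Real.pi / (-2 * x)
  have hF : ∀ y, HasDerivAt F (Real.exp (-y ^ 2) / Real.sqrt Real.pi * (1 - y / x)) y := by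
    intro y
    have h1 : HasDerivAt (fun y : ℝ => Real.exp (-y ^ 2)) (Real.exp (-y ^ 2) * (-(2 * y))) y := by
      have := ((hasDerivAt_pow 2 y).neg).exp
      simpa using this
    have h2 := (hasDerivAt_gcdf y).sub ((h1.div_const (Real.sqrt Real.pi)).div_const (-2 * x))
    refine h2.congr_deriv ?_
    have hx0 := hx.ne
    field_simp
  have hanti : AntitoneOn F (Set.Iic x) := by
    refine antitoneOn_of_deriv_nonpos (convex_Iic x)
      (fun y _ => (hF y).continuousAt.continuousWithinAt)
      (fun y _ => (hF y).differentiableAt.differentiableWithinAt) fun y hy => ?_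
    rw [interior_Iic] at hy
    rw [(hF y).deriv]
    have hy' : 1 ≤ y / x := by
      rw [le_div_iff_of_neg hx, one_mul]
      exact le_of_lt hy
    exact mul_nonpos_of_nonneg_of_nonpos (by positivity) (by linarith)
  have hlim : Tendsto F atBot (𝓝 0) := by
    have := tendsto_gcdf_atBot.sub
      ((tendsto_exp_neg_sq_atBot.div_const (Real.sqrt Real.pi)).div_const (-2 * x))
    rw [zero_div, zero_div, sub_zero] at this
    exact this
  have h0 : F x ≤ 0 := by
    refine ge_of_tendsto hlim ?_
    filter_upwards [eventually_le_atBot x] with y hy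
    exact hanti hy Set.self_mem_Iic hy
  have h1 : 0 < -2 * x := by linarith
  have h2 : gcdf x ≤ Real.exp (-x ^ 2) / Real.sqrt Real.pi / (-2 * x) := by
    have : F x = gcdf x - Real.exp (-x ^ 2) / Real.sqrt Real.pi / (-2 * x) := rfl
    linarith
  rw [le_div_iff₀ h1] at h2
  linarith

/-- The logarithmic derivative is the density over `gcdf`; the sign of its own derivative is that of
`-2 * x * gcdf x` minus the density, which is Mills' inequality. -/
theorem concaveOn_log_gcdf : ConcaveOn ℝ Set.univ fun x => Real.log (gcdf x) := by
  have hp : 0 < Real.sqrt Real.pi := Real.sqrt_pos.2 Real.pi_pos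
  have hd : ∀ x, HasDerivAt (fun x => Real.log (gcdf x))
      (Real.exp (-x ^ 2) / Real.sqrt Real.pi / gcdf x) x := fun x =>
    (hasDerivAt_gcdf x).log (gcdf_pos x).ne'
  have hderiv : deriv (fun x => Real.log (gcdf x)) =
      fun x => Real.exp (-x ^ 2) / Real.sqrt Real.pi / gcdf x := funext fun x => (hd x).deriv
  refine Antitone.concaveOn_univ_of_deriv (fun x => (hd x).differentiableAt) ?_
  rw [hderiv]
  have hd2 : ∀ x, HasDerivAt (fun x => Real.exp (-x ^ 2) / Real.sqrt Real.pi / gcdf x)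
      ((Real.exp (-x ^ 2) * (-(2 * x)) / Real.sqrt Real.pi * gcdf x -
        Real.exp (-x ^ 2) / Real.sqrt Real.pi * (Real.exp (-x ^ 2) / Real.sqrt Real.pi)) /
          gcdf x ^ 2) x := by
    intro x
    have h1 : HasDerivAt (fun y : ℝ => Real.exp (-y ^ 2)) (Real.exp (-x ^ 2) * (-(2 * x))) x := by
      have := ((hasDerivAt_pow 2 x).neg).exp
      simpa using this
    exact (h1.div_const (Real.sqrt Real.pi)).div (hasDerivAt_gcdf x) (gcdf_pos x).ne'
  refine antitone_of_deriv_nonpos (fun x => (hd2 x).differentiableAt) fun x => ?_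
  rw [(hd2 x).deriv]
  refine div_nonpos_of_nonpos_of_nonneg ?_ (sq_nonneg _)
  have h := neg_two_mul_gcdf_le x
  have h3 : 0 ≤ Real.exp (-x ^ 2) / Real.sqrt Real.pi := by positivity
  have e : Real.exp (-x ^ 2) * (-(2 * x)) / Real.sqrt Real.pi * gcdf x -
        Real.exp (-x ^ 2) / Real.sqrt Real.pi * (Real.exp (-x ^ 2) / Real.sqrt Real.pi) =
      Real.exp (-x ^ 2) / Real.sqrt Real.pi *
        (-2 * x * gcdf x - Real.exp (-x ^ 2) / Real.sqrt Real.pi) := by ring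
  rw [e]
  exact mul_nonpos_of_nonneg_of_nonpos h3 (by linarith)

theorem gcdf_mul_gcdf_le (a b : ℝ) : gcdf a * gcdf b ≤ gcdf ((a + b) / 2) ^ 2 := by
  have h := concaveOn_log_gcdf.2 (Set.mem_univ a) (Set.mem_univ b)
    (by norm_num : (0 : ℝ) ≤ 1 / 2) (by norm_num : (0 : ℝ) ≤ 1 / 2) (by norm_num)
  simp only [smul_eq_mul] at h
  have e : 1 / 2 * a + 1 / 2 * b = (a + b) / 2 := by ring
  rw [e] at h
  have hp := gcdf_pos ((a + b) / 2)
  rw [← Real.log_le_log_iff (mul_pos (gcdf_pos a) (gcdf_pos b)) (pow_pos hp 2),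
    Real.log_mul (gcdf_pos a).ne' (gcdf_pos b).ne', Real.log_pow]
  push_cast
  linarith

end GaussianDistributionFunction

/-! ### The function `w`: monotonicity, continuity and its root. -/

section GaussianEntropy

/-- The function under the supremum that defines `w`. -/
noncomputable def wTerm (h x : ℝ) : ℝ := -x ^ 2 + Real.log (1 + erf (x - h / Real.sqrt 2))

theorem one_add_erf_pos (x : ℝ) : 0 < 1 + erf x := by
  have := neg_one_lt_erf x
  linarith

theorem log_one_add_erf_le (x : ℝ) : Real.log (1 + erf x) ≤ Real.log 2 :=
  Real.log_le_log (one_add_erf_pos x) (by have := erf_lt_one x; linarith)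

theorem wTerm_le (h x : ℝ) : wTerm h x ≤ Real.log 2 - x ^ 2 := by
  have := log_one_add_erf_le (x - h / Real.sqrt 2)
  unfold wTerm
  linarith

theorem bddAbove_range_wTerm (h : ℝ) : BddAbove (Set.range (wTerm h)) := by
  refine ⟨Real.log 2, ?_⟩
  rintro _ ⟨x, rfl⟩
  have := wTerm_le h x
  nlinarith [sq_nonneg x]

theorem wTerm_le_w (h x : ℝ) : wTerm h x ≤ w h := le_ciSup (bddAbove_range_wTerm h) x

theorem continuous_wTerm (h : ℝ) : Continuous (wTerm h) := by
  unfold wTerm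
  refine (by fun_prop : Continuous fun x : ℝ => -x ^ 2).add (Continuous.log ?_ ?_)
  · exact continuous_const.add (continuous_erf.comp (by fun_prop))
  · exact fun x => (one_add_erf_pos _).ne'

/-- The logarithm is bounded by `log 2`, so `-x ^ 2` makes the term coercive. Attainment is what
makes the monotonicity of `w` strict. -/
theorem exists_wTerm_eq_w (h : ℝ) : ∃ x, wTerm h x = w h := by
  have hlim : Tendsto (wTerm h) (cocompact ℝ) atBot := by
    refine tendsto_atBot_mono (wTerm_le h) ?_
    have h1 : Tendsto (fun x : ℝ => x ^ 2) (cocompact ℝ) atTop := by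
      have h2 := (tendsto_pow_atTop (α := ℝ) two_ne_zero).comp (tendsto_norm_cocompact_atTop (E := ℝ))
      refine h2.congr fun x => ?_
      simp
    exact tendsto_atBot_add_const_left _ _ (tendsto_neg_atTop_atBot.comp h1)
  obtain ⟨x, hx⟩ := (continuous_wTerm h).exists_forall_ge hlim
  exact ⟨x, le_antisymm (wTerm_le_w h x) (ciSup_le hx)⟩

theorem strictAnti_w : StrictAnti w := by
  intro a b hab
  obtain ⟨x, hx⟩ := exists_wTerm_eq_w b
  rw [← hx]
  refine lt_of_lt_of_le ?_ (wTerm_le_w a x)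
  have h2 : 0 < Real.sqrt 2 := by positivity
  have h1 : x - b / Real.sqrt 2 < x - a / Real.sqrt 2 := by
    have := div_lt_div_of_pos_right hab h2
    linarith
  have h3 := Real.log_lt_log (one_add_erf_pos (x - b / Real.sqrt 2))
    (by have := strictMono_erf h1; linarith : _ < 1 + erf (x - a / Real.sqrt 2))
  unfold wTerm
  linarith

/-- After the substitution `x = y + h / √2`, each term plus `h ^ 2 / 2` is affine in `h`, so this is
a supremum of affine functions. Its purpose is the continuity of `w`. -/
theorem convexOn_w_add_sq : ConvexOn ℝ Set.univ fun h : ℝ => w h + h ^ 2 / 2 := by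
  refine ⟨convex_univ, fun a _ b _ s t hs ht hst => ?_⟩
  simp only [smul_eq_mul]
  obtain ⟨x, hx⟩ := exists_wTerm_eq_w (s * a + t * b)
  set y := x - (s * a + t * b) / Real.sqrt 2 with hy
  have key : ∀ c, wTerm c (y + c / Real.sqrt 2) + c ^ 2 / 2 =
      -y ^ 2 - 2 * y * (c / Real.sqrt 2) + Real.log (1 + erf y) := by
    intro c
    unfold wTerm
    have h2 : Real.sqrt 2 ^ 2 = 2 := Real.sq_sqrt (by norm_num)
    have h3 : (c / Real.sqrt 2) ^ 2 = c ^ 2 / 2 := by rw [div_pow, h2]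
    rw [add_sub_cancel_right]
    linear_combination (-1 : ℝ) * h3
  have hxy : x = y + (s * a + t * b) / Real.sqrt 2 := by rw [hy]; ring
  have k0 := key (s * a + t * b)
  rw [← hxy, hx] at k0
  have ka := key a
  have kb := key b
  have la := wTerm_le_w a (y + a / Real.sqrt 2)
  have lb := wTerm_le_w b (y + b / Real.sqrt 2)
  rw [k0]
  have e : -y ^ 2 - 2 * y * ((s * a + t * b) / Real.sqrt 2) + Real.log (1 + erf y) =
      s * (-y ^ 2 - 2 * y * (a / Real.sqrt 2) + Real.log (1 + erf y)) +
      t * (-y ^ 2 - 2 * y * (b / Real.sqrt 2) + Real.log (1 + erf y)) := by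
    linear_combination (-(-y ^ 2 + Real.log (1 + erf y))) * hst
  rw [e, ← ka, ← kb]
  have := mul_le_mul_of_nonneg_left la hs
  have := mul_le_mul_of_nonneg_left lb ht
  linarith

theorem continuous_w : Continuous w := by
  have h := convexOn_w_add_sq.continuousOn isOpen_univ
  rw [continuousOn_univ] at h
  have h2 := h.sub (by fun_prop : Continuous fun h : ℝ => h ^ 2 / 2)
  refine h2.congr fun x => ?_
  simp

theorem w_zero_nonneg : 0 ≤ w 0 := by
  have h := wTerm_le_w 0 0
  simpa [wTerm, erf_zero] using h

theorem exists_w_neg : ∃ h, w h < 0 := by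
  have h1 : ∀ᶠ x in atBot, erf x < Real.exp (-1) - 1 := by
    refine tendsto_erf_atBot.eventually_lt_const ?_
    have := Real.exp_pos (-1)
    linarith
  obtain ⟨y, hy, hy1⟩ := (h1.and (eventually_le_atBot (-2))).exists
  have h2 : 0 < Real.sqrt 2 := by positivity
  -- The argument of `erf` becomes `x + 2 * y`. If `x ≤ -y` it is at most `y`, and the logarithm is
  -- below `-1`; otherwise `x > 2`, and `x ^ 2` exceeds `log 2`.
  refine ⟨-2 * y * Real.sqrt 2, ?_⟩
  obtain ⟨x, hx⟩ := exists_wTerm_eq_w (-2 * y * Real.sqrt 2)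
  rw [← hx]
  have e : x - -2 * y * Real.sqrt 2 / Real.sqrt 2 = x + 2 * y := by
    field_simp
    ring
  rcases le_or_gt x (-y) with hxy | hxy
  · have h3 : erf (x + 2 * y) ≤ erf y := strictMono_erf.monotone (by linarith)
    have h4 : Real.log (1 + erf (x + 2 * y)) < -1 := by
      rw [Real.log_lt_iff_lt_exp (one_add_erf_pos _)]
      linarith
    unfold wTerm
    rw [e]
    nlinarith [sq_nonneg x]
  · have h3 := wTerm_le (-2 * y * Real.sqrt 2) x
    have h4 : Real.log 2 < 1 := by
      have := Real.log_two_lt_d9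
      linarith
    nlinarith

theorem existsUnique_w_eq_zero : ∃! hstar : ℝ, w hstar = 0 := by
  obtain ⟨b, hb⟩ := exists_w_neg
  obtain ⟨h, hh⟩ := mem_range_of_exists_le_of_exists_ge continuous_w ⟨b, hb.le⟩ ⟨0, w_zero_nonneg⟩
  exact ⟨h, hh, fun y hy => strictAnti_w.injective (hy.trans hh.symm)⟩

theorem pos_of_w_neg {h : ℝ} (hw : w h < 0) : 0 < h := by
  by_contra! hle
  have := strictAnti_w.antitone hle
  linarith [w_zero_nonneg]

theorem exp_neg_sq_mul_gcdf_le (h x : ℝ) :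
    Real.exp (-x ^ 2) * gcdf (x - h / Real.sqrt 2) ≤ Real.exp (w h) / 2 := by
  have h1 := Real.exp_le_exp.2 (wTerm_le_w h x)
  unfold wTerm at h1
  rw [Real.exp_add, Real.exp_log (one_add_erf_pos _)] at h1
  unfold gcdf
  linarith

end GaussianEntropy

/-! ### A uniform central limit theorem for differences of Poisson variables. -/

section PoissonDifference

open MeasureTheory ProbabilityTheory
open scoped NNReal

theorem gaussianReal_half_Ici (z : ℝ) :
    gaussianReal 0 (1 / 2) (Set.Ici z) = ENNReal.ofReal (gcdf (-z)) := by
  have hpdf : gaussianPDFReal 0 (1 / 2) = fun x => Real.exp (-x ^ 2) / Real.sqrt Real.pi := by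
    ext x
    simp [gaussianPDFReal, mul_comm, div_eq_mul_inv]
  rw [gaussianReal_apply_eq_integral _ (by norm_num), hpdf, integral_Ici_eq_integral_Ioi]
  have hd : ∀ x ∈ Set.Ici z, HasDerivAt (fun x => -gcdf (-x))
      (Real.exp (-x ^ 2) / Real.sqrt Real.pi) x := by
    intro x _
    have h := ((hasDerivAt_gcdf (-x)).comp x (hasDerivAt_neg x)).neg
    refine h.congr_deriv ?_
    rw [neg_sq]
    ring
  have hl : Tendsto (fun x => -gcdf (-x)) atTop (𝓝 0) := by
    simpa using (tendsto_gcdf_atBot.comp tendsto_neg_atTop_atBot).neg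
  rw [integral_Ioi_of_hasDerivAt_of_nonneg' hd (fun x _ => by positivity) hl]
  simp

/-- The law of a difference of two independent Poisson variables, centred and divided by `s`. -/
noncomputable def poissonDiff (x u : ℝ≥0) (s : ℝ) : Measure ℝ :=
  ((poissonMeasure x).prod (poissonMeasure u)).map
    fun p : ℕ × ℕ => ((p.1 : ℝ) - p.2 - (x - u)) / s

theorem measurable_poissonDiff_fun (x u : ℝ≥0) (s : ℝ) :
    Measurable fun p : ℕ × ℕ => ((p.1 : ℝ) - p.2 - (x - u)) / s := measurable_of_countable _

instance (x u : ℝ≥0) (s : ℝ) : IsProbabilityMeasure (poissonDiff x u s) :=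
  Measure.isProbabilityMeasure_map (measurable_poissonDiff_fun x u s).aemeasurable

theorem integral_cexp_poissonMeasure (r : ℝ≥0) (t : ℝ) :
    ∫ n : ℕ, Complex.exp (t * n * Complex.I) ∂poissonMeasure r =
      Complex.exp (r * (Complex.exp (t * Complex.I) - 1)) := by
  have h := charFun_map_cast_poissonMeasure r t
  rw [charFun_apply_real, integral_map measurable_from_top.aemeasurable
    (by fun_prop)] at h
  simpa using h

theorem charFun_poissonDiff (x u : ℝ≥0) (s t : ℝ) :
    charFun (poissonDiff x u s) t =
      Complex.exp (x * (Complex.exp ((t / s : ℝ) * Complex.I) - 1 - (t / s : ℝ) * Complex.I) +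
        u * (Complex.exp (-((t / s : ℝ) * Complex.I)) - 1 - -((t / s : ℝ) * Complex.I))) := by
  rw [charFun_apply_real, poissonDiff, integral_map
    (measurable_poissonDiff_fun x u s).aemeasurable (by fun_prop)]
  have e : ∀ p : ℕ × ℕ, Complex.exp (t * (((p.1 : ℝ) - p.2 - (x - u)) / s : ℝ) * Complex.I) =
      Complex.exp (-((t / s : ℝ) * (x - u) * Complex.I)) *
        (Complex.exp ((t / s : ℝ) * p.1 * Complex.I) *
          Complex.exp ((-(t / s) : ℝ) * p.2 * Complex.I)) := by
    intro p
    rw [← Complex.exp_add, ← Complex.exp_add]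
    congr 1
    push_cast
    ring
  simp_rw [e]
  rw [integral_const_mul, integral_prod_mul (μ := poissonMeasure x) (ν := poissonMeasure u)
    (fun n : ℕ => Complex.exp ((t / s : ℝ) * n * Complex.I))
    (fun n : ℕ => Complex.exp ((-(t / s) : ℝ) * n * Complex.I)),
    integral_cexp_poissonMeasure, integral_cexp_poissonMeasure, ← Complex.exp_add,
    ← Complex.exp_add]
  congr 1
  push_cast
  rw [neg_mul]
  ring

theorem norm_exp_sub_quadratic_le {z : ℂ} (hz : ‖z‖ ≤ 1) :
    ‖Complex.exp z - 1 - z - z ^ 2 / 2‖ ≤ ‖z‖ ^ 3 := by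
  have h := Complex.exp_bound hz (n := 3) (by norm_num)
  simp only [Finset.sum_range_succ, Finset.sum_range_zero, Nat.factorial] at h
  norm_num at h
  have e : Complex.exp z - 1 - z - z ^ 2 / 2 = Complex.exp z - (1 + z + z ^ 2 / 2) := by ring
  rw [e]
  refine h.trans ?_
  have : 0 ≤ ‖z‖ ^ 3 := by positivity
  linarith

/-- Only the variance `x + u ~ D` matters, not how it splits. With `θ = t / √(2D)`, the exponent of
the characteristic function is `-(x + u) θ² / 2`, tending to `-t² / 4`, up to an error `(x + u)
|θ|³` that vanishes. -/
theorem tendsto_poissonDiff (D : ℕ → ℝ) (x u : ℕ → ℝ≥0) (hD : Tendsto D atTop atTop)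
    (hxu : Tendsto (fun j => ((x j : ℝ) + u j) / D j) atTop (𝓝 1)) (t : ℝ) :
    Tendsto (fun j => charFun (poissonDiff (x j) (u j) (Real.sqrt (2 * D j))) t) atTop
      (𝓝 (charFun (gaussianReal 0 (1 / 2)) t)) := by
  simp_rw [charFun_poissonDiff, charFun_gaussianReal]
  refine (Complex.continuous_exp.tendsto _).comp ?_
  set θ : ℕ → ℝ := fun j => t / Real.sqrt (2 * D j) with hθ
  have hθ0 : Tendsto θ atTop (𝓝 0) := by
    refine Tendsto.const_div_atTop ?_ t
    exact Real.tendsto_sqrt_atTop.comp (hD.const_mul_atTop two_pos)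
  have hq : Tendsto (fun j => ((x j : ℝ) + u j) * θ j ^ 2) atTop (𝓝 (t ^ 2 / 2)) := by
    have h := hxu.mul_const (t ^ 2 / 2)
    rw [one_mul] at h
    refine h.congr' ?_
    filter_upwards [hD.eventually_gt_atTop 0] with j hj
    simp only [hθ, div_pow]
    rw [Real.sq_sqrt (by positivity)]
    field_simp
  have hmain : Tendsto (fun j => -((((x j : ℝ) + u j) * θ j ^ 2 : ℝ) : ℂ) / 2) atTop
      (𝓝 (-((t ^ 2 / 2 : ℝ) : ℂ) / 2)) :=
    (((Complex.continuous_ofReal.tendsto _).comp hq).neg).div_const 2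
  have herr : Tendsto (fun j => (x j * (Complex.exp (θ j * Complex.I) - 1 - θ j * Complex.I) +
      u j * (Complex.exp (-(θ j * Complex.I)) - 1 - -(θ j * Complex.I))) -
        -((((x j : ℝ) + u j) * θ j ^ 2 : ℝ) : ℂ) / 2) atTop (𝓝 0) := by
    have hb : Tendsto (fun j => (((x j : ℝ) + u j) * θ j ^ 2) * |θ j|) atTop (𝓝 0) := by
      have := hq.mul hθ0.abs
      simpa using this
    refine squeeze_zero_norm' ?_ hb
    have hsmall : ∀ᶠ j in atTop, |θ j| < 1 := by
      have := hθ0.abs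
      rw [abs_zero] at this
      exact this.eventually_lt_const one_pos
    filter_upwards [hsmall] with j hj
    have n1 : ‖(θ j * Complex.I : ℂ)‖ = |θ j| := by simp
    have n2 : ‖(-(θ j * Complex.I) : ℂ)‖ = |θ j| := by simp
    have b1 := norm_exp_sub_quadratic_le (z := θ j * Complex.I) (by rw [n1]; exact hj.le)
    have b2 := norm_exp_sub_quadratic_le (z := -(θ j * Complex.I)) (by rw [n2]; exact hj.le)
    rw [n1] at b1
    rw [n2] at b2
    have e : (x j * (Complex.exp (θ j * Complex.I) - 1 - θ j * Complex.I) +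
      u j * (Complex.exp (-(θ j * Complex.I)) - 1 - -(θ j * Complex.I))) -
        -((((x j : ℝ) + u j) * θ j ^ 2 : ℝ) : ℂ) / 2 =
      x j * (Complex.exp (θ j * Complex.I) - 1 - θ j * Complex.I - (θ j * Complex.I) ^ 2 / 2) +
      u j * (Complex.exp (-(θ j * Complex.I)) - 1 - -(θ j * Complex.I) -
        (-(θ j * Complex.I)) ^ 2 / 2) := by
      rw [neg_sq, mul_pow, Complex.I_sq]
      push_cast
      ring
    rw [e]
    refine (norm_add_le _ _).trans ?_
    rw [norm_mul, norm_mul]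
    have nx : ‖((x j : ℝ) : ℂ)‖ = x j := by simp
    have nu : ‖((u j : ℝ) : ℂ)‖ = u j := by simp
    rw [nx, nu]
    have e3 : (((x j : ℝ) + u j) * θ j ^ 2) * |θ j| = x j * |θ j| ^ 3 + u j * |θ j| ^ 3 := by
      rw [← sq_abs]
      ring
    rw [e3]
    exact add_le_add (mul_le_mul_of_nonneg_left b1 (x j).2)
      (mul_le_mul_of_nonneg_left b2 (u j).2)
  have h := herr.add hmain
  have e0 : (0 : ℂ) + -((t ^ 2 / 2 : ℝ) : ℂ) / 2 =
      (t : ℂ) * (0 : ℝ) * Complex.I - ((1 / 2 : ℝ≥0) : ℝ) * (t : ℂ) ^ 2 / 2 := by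
    push_cast
    ring
  rw [e0] at h
  refine h.congr fun j => ?_
  ring

/-- A grid of Gaussian quantiles, spaced by less than `ε` in probability; it upgrades pointwise
convergence of tails to a bound uniform in `y`. -/
theorem exists_grid {ε : ℝ} (hε : 0 < ε) :
    ∃ F : Finset ℝ, ∀ y, 1 ≤ gcdf (-y) + ε ∨ ∃ z ∈ F, z ≤ y ∧ gcdf (-z) ≤ gcdf (-y) + ε := by
  obtain ⟨N, hN⟩ := exists_nat_one_div_lt hε
  have hN0 : (0 : ℝ) < N + 1 := by positivity
  have hex : ∀ i : ℕ, ∃ z, i < N → gcdf (-z) = (i + 1) / (N + 1) := by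
    intro i
    by_cases hi : i < N
    · have hi' : (i : ℝ) + 1 < N + 1 := by
        have : (i : ℝ) < N := by exact_mod_cast hi
        linarith
      have h1 : ((i : ℝ) + 1) / (N + 1) < 1 := by rwa [div_lt_one hN0]
      have h0 : 0 < ((i : ℝ) + 1) / (N + 1) := by positivity
      obtain ⟨a, ha⟩ := (tendsto_gcdf_atBot.eventually_lt_const h0).exists
      obtain ⟨b, hb⟩ := (tendsto_gcdf_atTop.eventually_const_lt h1).exists
      obtain ⟨z, hz⟩ := mem_range_of_exists_le_of_exists_ge continuous_gcdf
        ⟨a, ha.le⟩ ⟨b, hb.le⟩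
      exact ⟨-z, fun _ => by rw [neg_neg, hz]⟩
    · exact ⟨0, fun h => absurd h hi⟩
  choose z hz using hex
  refine ⟨(Finset.range N).image z, fun y => ?_⟩
  set v := gcdf (-y) with hv
  have hv0 : 0 < v := gcdf_pos _
  have hfl := Nat.floor_le (mul_nonneg hv0.le hN0.le)
  have hfl2 := Nat.lt_floor_add_one (v * (N + 1))
  by_cases hi : ⌊v * ((N : ℝ) + 1)⌋₊ < N
  · right
    refine ⟨z ⌊v * ((N : ℝ) + 1)⌋₊, Finset.mem_image_of_mem _ (Finset.mem_range.2 hi), ?_, ?_⟩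
    · have h1 : gcdf (-y) < gcdf (-z ⌊v * ((N : ℝ) + 1)⌋₊) := by
        rw [hz _ hi, lt_div_iff₀ hN0]
        exact hfl2
      have := strictMono_gcdf.lt_iff_lt.1 h1
      linarith
    · rw [hz _ hi, add_div]
      refine add_le_add ?_ hN.le
      rwa [div_le_iff₀ hN0]
  · left
    push Not at hi
    have h1 : (N : ℝ) ≤ v * (N + 1) := by
      refine le_trans ?_ hfl
      exact_mod_cast hi
    have h2 : 1 - v ≤ 1 / ((N : ℝ) + 1) := by
      rw [le_div_iff₀ hN0]
      linarith
    linarith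

/-- Uniform Gaussian bound for the tails of a difference of independent Poisson variables. -/
theorem exists_poissonDiff_tail_le (C : ℝ) {ε : ℝ} (hε : 0 < ε) :
    ∃ D₀ : ℝ, ∀ D, D₀ ≤ D → ∀ x u : ℝ≥0, |(x : ℝ) + u - D| ≤ C * Real.sqrt D → ∀ y : ℝ,
      (poissonDiff x u (Real.sqrt (2 * D))).real (Set.Ici y) ≤ gcdf (-y) + ε := by
  -- Negation yields a sequence of bad parameters with `D → ∞`. The limit theorem along this one
  -- sequence gives uniformity in `x` and `u`; the grid handles the varying `y j`.
  by_contra! hcon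
  choose D hD x u hxu y hy using fun j : ℕ => hcon ((j : ℝ) + 1)
  have hDlim : Tendsto D atTop atTop := by
    refine tendsto_atTop_mono hD ?_
    exact tendsto_atTop_add_const_right _ _ tendsto_natCast_atTop_atTop
  have hDpos : ∀ j, 0 < D j := fun j => lt_of_lt_of_le (by positivity) (hD j)
  have hratio : Tendsto (fun j => ((x j : ℝ) + u j) / D j) atTop (𝓝 1) := by
    have h0 : Tendsto (fun j => C / Real.sqrt (D j)) atTop (𝓝 0) :=
      (Real.tendsto_sqrt_atTop.comp hDlim).const_div_atTop C
    rw [tendsto_iff_norm_sub_tendsto_zero]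
    refine squeeze_zero (fun _ => norm_nonneg _) (fun j => ?_) h0
    have e : ((x j : ℝ) + u j) / D j - 1 = ((x j : ℝ) + u j - D j) / D j := by
      have := (hDpos j).ne'
      field_simp
    rw [e, Real.norm_eq_abs, abs_div, abs_of_pos (hDpos j), div_le_div_iff₀ (hDpos j)
      (Real.sqrt_pos.2 (hDpos j))]
    calc |(x j : ℝ) + u j - D j| * Real.sqrt (D j)
        ≤ C * Real.sqrt (D j) * Real.sqrt (D j) :=
          mul_le_mul_of_nonneg_right (hxu j) (Real.sqrt_nonneg _)
      _ = C * D j := by rw [mul_assoc, Real.mul_self_sqrt (hDpos j).le]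
  let μ : ℕ → ProbabilityMeasure ℝ := fun j =>
    ⟨poissonDiff (x j) (u j) (Real.sqrt (2 * D j)), inferInstance⟩
  let γ : ProbabilityMeasure ℝ := ⟨gaussianReal 0 (1 / 2), inferInstance⟩
  have hlim : Tendsto μ atTop (𝓝 γ) :=
    ProbabilityMeasure.tendsto_of_tendsto_charFun (tendsto_poissonDiff D x u hDlim hratio)
  have hpt : ∀ z : ℝ, ∀ᶠ j in atTop, (μ j : Measure ℝ).real (Set.Ici z) < gcdf (-z) + ε / 2 := by
    intro z
    have hfr : (γ : Measure ℝ) (frontier (Set.Ici z)) = 0 := by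
      rw [frontier_Ici]
      have : NullSingletonClass (gaussianReal 0 (1 / 2)) :=
        nullSingletonClass_gaussianReal (by norm_num)
      exact measure_singleton (μ := gaussianReal 0 (1 / 2)) z
    have h := ProbabilityMeasure.tendsto_measure_of_null_frontier_of_tendsto' hlim hfr
    have hg : (γ : Measure ℝ) (Set.Ici z) = ENNReal.ofReal (gcdf (-z)) := gaussianReal_half_Ici z
    rw [hg] at h
    have h2 := (ENNReal.tendsto_toReal ENNReal.ofReal_ne_top).comp h
    rw [ENNReal.toReal_ofReal (gcdf_pos _).le] at h2
    exact h2.eventually_lt_const (by linarith)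
  obtain ⟨F, hF⟩ := exists_grid (half_pos hε)
  obtain ⟨j, hj⟩ := ((F.eventually_all).2 fun z _ => hpt z).exists
  have hyj := hy j
  rcases hF (y j) with h1 | ⟨z, hzF, hzy, hz⟩
  · have := measureReal_le_one (μ := poissonDiff (x j) (u j) (Real.sqrt (2 * D j)))
      (s := Set.Ici (y j))
    linarith
  · have h3 := hj z hzF
    have h4 : (poissonDiff (x j) (u j) (Real.sqrt (2 * D j))).real (Set.Ici (y j)) ≤
        (poissonDiff (x j) (u j) (Real.sqrt (2 * D j))).real (Set.Ici z) :=
      measureReal_mono (Set.Ici_subset_Ici.2 hzy)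
    have h5 : (μ j : Measure ℝ).real (Set.Ici z) =
        (poissonDiff (x j) (u j) (Real.sqrt (2 * D j))).real (Set.Ici z) := rfl
    linarith

end PoissonDifference

/-! ### Balls in boxes and Poisson domination. -/

section Multinomial

variable {V C H : Type*} [Fintype V] [DecidableEq V] [Fintype C] [DecidableEq C] [Fintype H]

/-- The number of balls of each class in the box `v`, when the ball `a` of class `χ a` is put into
the box `e a`. -/
def occupancy (χ : H → C) (e : H → V) (v : V) (c : C) : ℕ :=
  (Finset.univ.filter fun a => e a = v ∧ χ a = c).card

/-- The number of balls of class `c`. -/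
def classCard (χ : H → C) (c : C) : ℕ := (Finset.univ.filter fun a => χ a = c).card

theorem prod_comp_eq_prod_pow_classCard {R : Type*} [CommMonoid R] (χ : H → C) (f : C → R) :
    ∏ a, f (χ a) = ∏ c, f c ^ classCard χ c := by
  rw [← Finset.prod_fiberwise' Finset.univ χ f]
  simp [classCard]

theorem sum_classCard (χ : H → C) : ∑ c, classCard χ c = Fintype.card H := by
  unfold classCard
  rw [← Finset.card_eq_sum_card_fiberwise (fun a _ => Finset.mem_univ (χ a)), Finset.card_univ]

variable [DecidableEq H]

/-- The linear functional on polynomials that maps the monomial with exponents `m` to `Φ m`. -/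
noncomputable def monomialFunctional {ι : Type*} (Φ : (ι →₀ ℕ) → ℝ) :
    MvPolynomial ι ℝ →ₗ[ℝ] ℝ :=
  (MvPolynomial.basisMonomials ι ℝ).constr ℝ Φ

theorem monomialFunctional_monomial {ι : Type*} (Φ : (ι →₀ ℕ) → ℝ) (m : ι →₀ ℕ) (r : ℝ) :
    monomialFunctional Φ (MvPolynomial.monomial m r) = r * Φ m := by
  have h1 : MvPolynomial.monomial m r = r • MvPolynomial.basisMonomials ι ℝ m := by
    simp [MvPolynomial.smul_monomial]
  rw [h1, map_smul, monomialFunctional, Module.Basis.constr_basis, smul_eq_mul]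

/-- The polynomial `∏ a, ∑ v, X (v, χ a)` is expanded once over assignments and once by the
multinomial theorem in each class. A linear functional then replaces each monomial by the product of
the values of `Ψ`. -/
theorem sum_prod_occupancy (χ : H → C) (Ψ : V → (C → ℕ) → ℝ) :
    ∑ e : H → V, ∏ v, Ψ v (occupancy χ e v) =
      ∑ k ∈ Fintype.piFinset fun c => (Finset.univ : Finset V).piAntidiag (classCard χ c),
        (∏ c, (Nat.multinomial Finset.univ (k c) : ℝ)) * ∏ v, Ψ v fun c => k c v := by
  classical
  let Φ : (V × C →₀ ℕ) → ℝ := fun m => ∏ v, Ψ v fun c => m (v, c)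
  let P : MvPolynomial (V × C) ℝ := ∏ a : H, ∑ v, MvPolynomial.X (v, χ a)
  have h1 : P = ∑ e : H → V, MvPolynomial.monomial (∑ a, Finsupp.single (e a, χ a) 1) 1 := by
    have := Finset.prod_univ_sum (fun _ : H => (Finset.univ : Finset V))
      (fun a v => (MvPolynomial.X (v, χ a) : MvPolynomial (V × C) ℝ))
    rw [Fintype.piFinset_univ] at this
    simp only [P, this]
    refine Finset.sum_congr rfl fun e _ => ?_
    rw [MvPolynomial.monomial_sum_one]
    rfl
  have h2 : P = ∑ k ∈ Fintype.piFinset fun c =>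
      (Finset.univ : Finset V).piAntidiag (classCard χ c),
      MvPolynomial.monomial (∑ c, ∑ v, Finsupp.single (v, c) (k c v))
        (∏ c, (Nat.multinomial Finset.univ (k c) : ℝ)) := by
    have h3 : P = ∏ c, (∑ v, (MvPolynomial.X (v, c) : MvPolynomial (V × C) ℝ)) ^ classCard χ c :=
      prod_comp_eq_prod_pow_classCard χ
        fun c => ∑ v, (MvPolynomial.X (v, c) : MvPolynomial (V × C) ℝ)
    rw [h3]
    simp_rw [Finset.sum_pow_eq_sum_piAntidiag]
    rw [Finset.prod_univ_sum]
    refine Finset.sum_congr rfl fun k _ => ?_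
    rw [MvPolynomial.monomial_sum_prod]
    refine Finset.prod_congr rfl fun c _ => ?_
    rw [MvPolynomial.monomial_sum_index, map_natCast]
    simp_rw [MvPolynomial.X_pow_eq_monomial]
  have h3 := congrArg (monomialFunctional Φ) (h1.symm.trans h2)
  simp only [map_sum, monomialFunctional_monomial, one_mul] at h3
  have e1 : ∀ e : H → V, Φ (∑ a, Finsupp.single (e a, χ a) 1) = ∏ v, Ψ v (occupancy χ e v) := by
    intro e
    refine Finset.prod_congr rfl fun v _ => congrArg (Ψ v) (funext fun c => ?_)
    simp only [Finsupp.finsetSum_apply, Finsupp.single_apply, Prod.mk.injEq, occupancy,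
      Finset.card_filter]
  have e2 : ∀ k : C → V → ℕ, Φ (∑ c, ∑ v, Finsupp.single (v, c) (k c v)) =
      ∏ v, Ψ v fun c => k c v := by
    intro k
    refine Finset.prod_congr rfl fun v _ => congrArg (Ψ v) (funext fun c => ?_)
    simp only [Finsupp.finsetSum_apply, Finsupp.single_apply, Prod.mk.injEq]
    rw [Finset.sum_eq_single c (fun c' _ hc => by simp [hc]) (by simp),
      Finset.sum_eq_single v (fun v' _ hv => by simp [hv]) (by simp)]
    simp
  simp only [e1, e2] at h3
  exact h3

/-- Occupancy numbers of balls that are thrown into boxes are dominated by independent ones with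
Poisson weights. -/
theorem sum_prod_occupancy_le (χ : H → C) (Ψ : V → (C → ℕ) → ℝ) (hΨ : ∀ v N, 0 ≤ Ψ v N) :
    ∑ e : H → V, ∏ v, Ψ v (occupancy χ e v) ≤
      (∏ c, ((classCard χ c).factorial : ℝ)) *
        ∏ v, ∑ N ∈ Fintype.piFinset fun _ : C => Finset.range (Fintype.card H + 1),
          Ψ v N / ∏ c, ((N c).factorial : ℝ) := by
  classical
  rw [sum_prod_occupancy, Finset.prod_univ_sum, Finset.mul_sum]
  have hterm : ∀ k ∈ Fintype.piFinset fun c => (Finset.univ : Finset V).piAntidiag (classCard χ c),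
      (∏ c, (Nat.multinomial Finset.univ (k c) : ℝ)) * ∏ v, Ψ v (fun c => k c v) =
      (∏ c, ((classCard χ c).factorial : ℝ)) *
        ∏ v, (Ψ v (fun c => k c v) / ∏ c, ((k c v).factorial : ℝ)) := by
    intro k hk
    rw [Finset.prod_div_distrib, Finset.prod_comm]
    have h1 : ∏ c, ((classCard χ c).factorial : ℝ) =
        (∏ c, ∏ v, ((k c v).factorial : ℝ)) * ∏ c, (Nat.multinomial Finset.univ (k c) : ℝ) := by
      rw [← Finset.prod_mul_distrib]
      refine Finset.prod_congr rfl fun c _ => ?_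
      have h2 := Nat.multinomial_spec Finset.univ (k c)
      have h3 := (Finset.mem_piAntidiag.1 (Fintype.mem_piFinset.1 hk c)).1
      rw [h3] at h2
      rw [← h2]
      push_cast
      ring
    have h0 : (∏ c, ∏ v, ((k c v).factorial : ℝ)) ≠ 0 :=
      Finset.prod_ne_zero_iff.2 fun c _ => Finset.prod_ne_zero_iff.2 fun v _ => by
        exact_mod_cast (k c v).factorial_ne_zero
    rw [h1]
    field_simp
  rw [Finset.sum_congr rfl hterm]
  let sw : (C → V → ℕ) → V → C → ℕ := fun k v c => k c v
  have hinj : Function.Injective sw := fun k k' h =>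
    funext fun c => funext fun v => congrFun (congrFun h v) c
  rw [← Finset.sum_image (s := Fintype.piFinset fun c =>
    (Finset.univ : Finset V).piAntidiag (classCard χ c)) (g := sw)
    (f := fun N : V → C → ℕ => (∏ c, ((classCard χ c).factorial : ℝ)) *
        ∏ v, (Ψ v (N v) / ∏ c, ((N v c).factorial : ℝ))) (hinj.injOn)]
  -- The constraint that the occupancies of a class add up to its size is dropped here; without it
  -- the sum factorizes over the boxes.
  refine Finset.sum_le_sum_of_subset_of_nonneg ?_ fun N _ _ => ?_
  · intro N hN
    obtain ⟨k, hk, rfl⟩ := Finset.mem_image.1 hN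
    refine Fintype.mem_piFinset.2 fun v => Fintype.mem_piFinset.2 fun c => ?_
    have h3 := (Finset.mem_piAntidiag.1 (Fintype.mem_piFinset.1 hk c)).1
    have h4 : k c v ≤ ∑ v, k c v := Finset.single_le_sum (fun _ _ => Nat.zero_le _)
      (Finset.mem_univ v)
    have h5 : classCard χ c ≤ Fintype.card H := Finset.card_le_univ _
    exact Finset.mem_range.2 (Nat.lt_succ_of_le ((h4.trans h3.le).trans h5))
  · exact mul_nonneg (Finset.prod_nonneg fun _ _ => by positivity)
      (Finset.prod_nonneg fun v _ => div_nonneg (hΨ v _)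
        (Finset.prod_nonneg fun _ _ => by positivity))

/-- Occupancies of class `c` always total `classCard χ c`, so weighting each ball by `ρ` only
produces a constant factor. The rates are thus free parameters, to be optimized later. -/
theorem prod_pow_mul_sum_prod_occupancy_le (χ : H → C) (ρ : C → ℝ) (hρ : ∀ c, 0 ≤ ρ c)
    (Ψ : V → (C → ℕ) → ℝ) (hΨ : ∀ v N, 0 ≤ Ψ v N) :
    (∏ c, ρ c ^ classCard χ c) * ∑ e : H → V, ∏ v, Ψ v (occupancy χ e v) ≤
      (∏ c, ((classCard χ c).factorial : ℝ)) *
        ∏ v, ∑ N ∈ Fintype.piFinset fun _ : C => Finset.range (Fintype.card H + 1),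
          Ψ v N * ∏ c, (ρ c ^ N c / ((N c).factorial : ℝ)) := by
  have h := sum_prod_occupancy_le χ (fun v N => Ψ v N * ∏ c, ρ c ^ N c) fun v N =>
    mul_nonneg (hΨ v N) (Finset.prod_nonneg fun c _ => pow_nonneg (hρ c) _)
  have e1 : ∀ e : H → V, ∏ v, (Ψ v (occupancy χ e v) * ∏ c, ρ c ^ occupancy χ e v c) =
      (∏ c, ρ c ^ classCard χ c) * ∏ v, Ψ v (occupancy χ e v) := by
    intro e
    rw [Finset.prod_mul_distrib, mul_comm, Finset.prod_comm]
    congr 1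
    refine Finset.prod_congr rfl fun c _ => ?_
    rw [Finset.prod_pow_eq_pow_sum]
    congr 1
    unfold occupancy classCard
    rw [Finset.card_eq_sum_card_fiberwise (f := e) (t := Finset.univ)
      (fun a _ => Finset.mem_univ (e a))]
    refine Finset.sum_congr rfl fun v _ => ?_
    rw [Finset.filter_filter]
    simp only [and_comm]
  simp only [e1] at h
  rw [← Finset.mul_sum] at h
  simpa only [Finset.prod_div_distrib, mul_div_assoc] using h

end Multinomial

/-! ### Stability of a vertex in terms of its cut and uncut half-edges. -/

section LocalFields

variable {n m : ℕ}

/-- The other end of the edge of the half-edge `a`. -/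
def mate (a : Fin m × Bool) : Fin m × Bool := (a.1, !a.2)

theorem mate_mate (a : Fin m × Bool) : mate (mate a) = a := by simp [mate]

/-- The pair formed by the spin at a half-edge and the spin at its mate. -/
def spinClass (τ : Fin m × Bool → ℤˣ) (a : Fin m × Bool) : ℤˣ × ℤˣ := (τ a, τ (mate a))

/-- The number of cut half-edges at `v` minus the number of uncut ones. -/
noncomputable def cutExcess (e : Multigraph n m) (σ : Config n) (v : Fin n) : ℝ :=
  (occupancy (spinClass (σ ∘ e)) e v (σ v, -σ v) : ℝ) -
    occupancy (spinClass (σ ∘ e)) e v (σ v, σ v)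

theorem units_prod {M : Type*} [CommMonoid M] (s : ℤˣ) (f : ℤˣ → M) :
    ∏ t, f t = f (-s) * f s := by
  have h : (Finset.univ : Finset ℤˣ) = {1, -1} := by decide
  rw [h, Finset.prod_pair (by decide)]
  rcases Int.units_eq_one_or s with rfl | rfl
  · rw [mul_comm]
  · rw [neg_neg]

theorem units_sum {M : Type*} [AddCommMonoid M] (s : ℤˣ) (f : ℤˣ → M) :
    ∑ t, f t = f (-s) + f s := by
  have h : (Finset.univ : Finset ℤˣ) = {1, -1} := by decide
  rw [h, Finset.sum_pair (by decide)]
  rcases Int.units_eq_one_or s with rfl | rfl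
  · rw [add_comm]
  · rw [neg_neg]

theorem units_eq_neg_or_eq (s t : ℤˣ) : t = -s ∨ t = s := by
  rcases Int.units_eq_one_or s with rfl | rfl <;> rcases Int.units_eq_one_or t with rfl | rfl <;>
    simp

theorem units_ne_neg (s : ℤˣ) : s ≠ -s := by
  rcases Int.units_eq_one_or s with rfl | rfl <;> decide

theorem stability_weight (d : ℝ) (e : Multigraph n m) (σ : Config n) (v : Fin n) :
    stability d (weight e) σ v = 1 / Real.sqrt d * cutExcess e σ v := by
  unfold stability
  congr 1
  have h1 : ∑ j, weight e v j * spin σ j =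
      -∑ a, if e a = v then spin σ (e (mate a)) else 0 := by
    rw [← Finset.sum_neg_distrib]
    have h2 : ∀ j, weight e v j * spin σ j =
        ∑ a, if e a = v ∧ e (mate a) = j then -spin σ j else 0 := by
      intro j
      unfold weight adjCount
      rw [← Finset.sum_filter, Finset.sum_const, nsmul_eq_mul]
      unfold mate
      ring
    simp_rw [h2]
    rw [Finset.sum_comm]
    refine Finset.sum_congr rfl fun a _ => ?_
    by_cases hv : e a = v <;> simp [hv]
  have h3 : ∀ s, (occupancy (spinClass (σ ∘ e)) e v (σ v, s) : ℝ) =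
      ∑ a, if e a = v then (if σ (e (mate a)) = s then 1 else 0) else 0 := by
    intro s
    unfold occupancy spinClass
    rw [Finset.card_filter]
    push_cast
    refine Finset.sum_congr rfl fun a _ => ?_
    by_cases hv : e a = v <;> simp [hv]
  unfold cutExcess
  rw [h1, h3, h3, mul_neg, Finset.mul_sum, ← Finset.sum_neg_distrib, ← Finset.sum_sub_distrib]
  refine Finset.sum_congr rfl fun a _ => ?_
  by_cases hv : e a = v
  · simp only [hv, if_true]
    unfold spin
    rcases units_eq_neg_or_eq (σ v) (σ (e (mate a))) with h | h
    · rw [h]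
      simp only [if_true, (units_ne_neg (σ v)).symm, if_false]
      rcases Int.units_eq_one_or (σ v) with h' | h' <;> rw [h'] <;> norm_num
    · rw [h]
      simp only [if_true, units_ne_neg (σ v), if_false]
      rcases Int.units_eq_one_or (σ v) with h' | h' <;> rw [h'] <;> norm_num
  · simp [hv]

/-- The contribution of a vertex of spin `s` with occupancy numbers `N` to the partition function of
the edge ends that are compatible with the spins. -/
noncomputable def vertexWeight (φ : ℝ → ℝ) (s : ℤˣ) (N : ℤˣ × ℤˣ → ℕ) : ℝ :=
  if ∀ c : ℤˣ × ℤˣ, c.1 ≠ s → N c = 0 then φ ((N (s, -s) : ℝ) - N (s, s)) else 0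

theorem vertexWeight_nonneg {φ : ℝ → ℝ} (hφ : ∀ x, 0 ≤ φ x) (s : ℤˣ) (N : ℤˣ × ℤˣ → ℕ) :
    0 ≤ vertexWeight φ s N := by
  unfold vertexWeight
  split_ifs
  · exact hφ _
  · exact le_rfl

theorem vertexWeight_occupancy (φ : ℝ → ℝ) (e : Multigraph n m) (σ : Config n) (v : Fin n) :
    vertexWeight φ (σ v) (occupancy (spinClass (σ ∘ e)) e v) = φ (cutExcess e σ v) := by
  unfold vertexWeight
  rw [if_pos]
  · rfl
  · intro c hc
    unfold occupancy
    rw [Finset.card_eq_zero, Finset.filter_eq_empty_iff]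
    rintro a - ⟨h1, h2⟩
    refine hc ?_
    rw [← h2, ← h1]
    rfl

/-- Compatibility kills the two classes of the wrong spin, whose Poisson weight at `0` is `1`, so
only the numbers of cut and uncut half-edges remain. -/
theorem sum_vertexWeight_le {φ : ℝ → ℝ} (hφ : ∀ x, 0 ≤ φ x) (s : ℤˣ) {ρ : ℤˣ × ℤˣ → ℝ}
    (hρ : ∀ c, 0 ≤ ρ c) (B : ℕ) :
    ∑ N ∈ Fintype.piFinset fun _ : ℤˣ × ℤˣ => Finset.range B,
      vertexWeight φ s N * ∏ c, (ρ c ^ N c / ((N c).factorial : ℝ)) ≤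
    ∑ p ∈ Finset.range B ×ˢ Finset.range B, φ ((p.1 : ℝ) - p.2) *
      (ρ (s, -s) ^ p.1 / (p.1.factorial : ℝ) * (ρ (s, s) ^ p.2 / (p.2.factorial : ℝ))) := by
  classical
  set S := (Fintype.piFinset fun _ : ℤˣ × ℤˣ => Finset.range B).filter
    fun N => ∀ c : ℤˣ × ℤˣ, c.1 ≠ s → N c = 0 with hS
  let g : (ℤˣ × ℤˣ → ℕ) → ℕ × ℕ := fun N => (N (s, -s), N (s, s))
  let F : ℕ × ℕ → ℝ := fun p => φ ((p.1 : ℝ) - p.2) *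
      (ρ (s, -s) ^ p.1 / (p.1.factorial : ℝ) * (ρ (s, s) ^ p.2 / (p.2.factorial : ℝ)))
  have h1 : ∑ N ∈ Fintype.piFinset fun _ : ℤˣ × ℤˣ => Finset.range B,
      vertexWeight φ s N * ∏ c, (ρ c ^ N c / ((N c).factorial : ℝ)) = ∑ N ∈ S, F (g N) := by
    rw [hS, Finset.sum_filter]
    refine Finset.sum_congr rfl fun N _ => ?_
    unfold vertexWeight
    split_ifs with h
    · simp only [F, g]
      congr 1
      rw [Fintype.prod_prod_type, Finset.prod_eq_single s, units_prod s]
      · intro t _ ht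
        refine Finset.prod_eq_one fun t' _ => ?_
        rw [h (t, t') ht]
        simp
      · exact fun hs => absurd (Finset.mem_univ s) hs
    · rw [zero_mul]
  have hinj : Set.InjOn g S := by
    intro N hN N' hN' hgg
    have hN1 := (Finset.mem_filter.1 hN).2
    have hN2 := (Finset.mem_filter.1 hN').2
    have hg := Prod.mk.inj hgg
    funext ⟨t, t'⟩
    by_cases ht : t = s
    · subst ht
      rcases units_eq_neg_or_eq t t' with rfl | rfl
      · exact hg.1
      · exact hg.2
    · rw [hN1 (t, t') ht, hN2 (t, t') ht]
  rw [h1, ← Finset.sum_image (f := F) hinj]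
  refine Finset.sum_le_sum_of_subset_of_nonneg ?_ fun p _ _ => ?_
  · intro p hp
    obtain ⟨N, hN, rfl⟩ := Finset.mem_image.1 hp
    have hN1 := Fintype.mem_piFinset.1 (Finset.mem_filter.1 hN).1
    exact Finset.mem_product.2 ⟨hN1 _, hN1 _⟩
  · exact mul_nonneg (hφ _) (mul_nonneg (div_nonneg (pow_nonneg (hρ _) _) (by positivity))
      (div_nonneg (pow_nonneg (hρ _) _) (by positivity)))

open MeasureTheory ProbabilityTheory in
/-- The probability that the difference of independent Poisson variables with means `x` and `u` is
at least `t`. -/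
noncomputable def poissonTail (x u t : ℝ) : ℝ :=
  ((poissonMeasure x.toNNReal).prod (poissonMeasure u.toNNReal)).real
    {p : ℕ × ℕ | t ≤ (p.1 : ℝ) - p.2}

theorem poissonTail_nonneg (x u t : ℝ) : 0 ≤ poissonTail x u t :=
  MeasureTheory.measureReal_nonneg

theorem poissonTail_le_one (x u t : ℝ) : poissonTail x u t ≤ 1 :=
  MeasureTheory.measureReal_le_one

/-- A smoothed indicator of the half-line `[t, ∞)`. -/
noncomputable def softStep (δ t y : ℝ) : ℝ := δ + if t ≤ y then 1 else 0

theorem softStep_nonneg {δ : ℝ} (hδ : 0 ≤ δ) (t y : ℝ) : 0 ≤ softStep δ t y := by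
  unfold softStep
  split_ifs <;> linarith

theorem sum_softStep_le {δ : ℝ} (hδ : 0 ≤ δ) (t : ℝ) {x u : ℝ} (hx : 0 ≤ x) (hu : 0 ≤ u) (B : ℕ) :
    ∑ p ∈ Finset.range B ×ˢ Finset.range B, softStep δ t ((p.1 : ℝ) - p.2) *
      (x ^ p.1 / (p.1.factorial : ℝ) * (u ^ p.2 / (p.2.factorial : ℝ))) ≤
    Real.exp (x + u) * (δ + poissonTail x u t) := by
  classical
  set μ := (ProbabilityTheory.poissonMeasure x.toNNReal).prod
    (ProbabilityTheory.poissonMeasure u.toNNReal) with hμ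
  have hpt : ∀ p : ℕ × ℕ, x ^ p.1 / (p.1.factorial : ℝ) * (u ^ p.2 / (p.2.factorial : ℝ)) =
      Real.exp (x + u) * μ.real {p} := by
    intro p
    have h1 : ({p} : Set (ℕ × ℕ)) = {p.1} ×ˢ {p.2} := by simp
    rw [h1, hμ, MeasureTheory.measureReal_prod_prod, ProbabilityTheory.poissonMeasure_real_singleton,
      ProbabilityTheory.poissonMeasure_real_singleton, Real.coe_toNNReal _ hx,
      Real.coe_toNNReal _ hu, Real.exp_add, Real.exp_neg, Real.exp_neg]
    have := (Real.exp_pos x).ne'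
    have := (Real.exp_pos u).ne'
    field_simp
  have hsum : ∀ S : Finset (ℕ × ℕ), ∑ p ∈ S, μ.real {p} = μ.real S := fun S =>
    MeasureTheory.sum_measureReal_singleton S
  have e : ∀ p : ℕ × ℕ, softStep δ t ((p.1 : ℝ) - p.2) *
      (x ^ p.1 / (p.1.factorial : ℝ) * (u ^ p.2 / (p.2.factorial : ℝ))) =
      Real.exp (x + u) * (δ * μ.real {p} + if t ≤ (p.1 : ℝ) - p.2 then μ.real {p} else 0) := by
    intro p
    rw [hpt]
    unfold softStep
    split_ifs <;> ring
  simp_rw [e]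
  rw [← Finset.mul_sum, Finset.sum_add_distrib, ← Finset.mul_sum, ← Finset.sum_filter, hsum, hsum]
  refine mul_le_mul_of_nonneg_left (add_le_add ?_ ?_) (Real.exp_pos _).le
  · have := MeasureTheory.measureReal_le_one (μ := μ)
      (s := ((Finset.range B ×ˢ Finset.range B : Finset (ℕ × ℕ)) : Set (ℕ × ℕ)))
    nlinarith
  · refine MeasureTheory.measureReal_mono fun p hp => ?_
    exact (Finset.mem_filter.1 hp).2

/-- The edge ends compatible with prescribed spins `τ` of the half-edges. -/
theorem prod_pow_mul_sum_softStep_le {δ : ℝ} (hδ : 0 ≤ δ) (t : ℝ) (σ : Config n)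
    (τ : Fin m × Bool → ℤˣ) {ρ : ℤˣ × ℤˣ → ℝ} (hρ : ∀ c, 0 ≤ ρ c) :
    (∏ c, ρ c ^ classCard (spinClass τ) c) *
      ∑ e : Multigraph n m with σ ∘ e = τ, ∏ v, softStep δ t (cutExcess e σ v) ≤
    (∏ c, ((classCard (spinClass τ) c).factorial : ℝ)) *
      ∏ v, (Real.exp (ρ (σ v, -σ v) + ρ (σ v, σ v)) *
        (δ + poissonTail (ρ (σ v, -σ v)) (ρ (σ v, σ v)) t)) := by
  have hφ := softStep_nonneg hδ t
  have hΨ : ∀ v N, 0 ≤ vertexWeight (softStep δ t) (σ v) N := fun v N => vertexWeight_nonneg hφ _ _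
  have h1 := prod_pow_mul_sum_prod_occupancy_le (V := Fin n) (spinClass τ) ρ hρ
    (fun v N => vertexWeight (softStep δ t) (σ v) N) hΨ
  have hprod : 0 ≤ ∏ c, ρ c ^ classCard (spinClass τ) c :=
    Finset.prod_nonneg fun c _ => pow_nonneg (hρ c) _
  refine le_trans (mul_le_mul_of_nonneg_left ?_ hprod) (h1.trans (mul_le_mul_of_nonneg_left
    (Finset.prod_le_prod (fun v _ => ?_) fun v _ => ?_) (by positivity)))
  · have h2 : ∑ e : Multigraph n m with σ ∘ e = τ, ∏ v, softStep δ t (cutExcess e σ v) =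
        ∑ e : Multigraph n m with σ ∘ e = τ,
          ∏ v, vertexWeight (softStep δ t) (σ v) (occupancy (spinClass τ) e v) := by
      refine Finset.sum_congr rfl fun e he => Finset.prod_congr rfl fun v _ => ?_
      rw [← (Finset.mem_filter.1 he).2, vertexWeight_occupancy]
    rw [h2]
    exact Finset.sum_le_sum_of_subset_of_nonneg (Finset.subset_univ _)
      fun e _ _ => Finset.prod_nonneg fun v _ => hΨ _ _
  · exact Finset.sum_nonneg fun N _ => mul_nonneg (hΨ _ _) (Finset.prod_nonneg fun c _ =>
      div_nonneg (pow_nonneg (hρ c) _) (by positivity))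
  · exact (sum_vertexWeight_le hφ (σ v) hρ _).trans (sum_softStep_le hδ t (hρ _) (hρ _) _)

end LocalFields

/-! ### Summing over spin patterns of a given type. -/

section TypeCounting

variable {n m : ℕ}

/-- A Stirling bound with polynomial loss; the induction step is `e ≤ ((k + 2) / (k + 1)) ^ (k +
2)`. -/
theorem factorial_mul_exp_le (K : ℕ) :
    (K.factorial : ℝ) * Real.exp 1 ^ K ≤ Real.exp 1 * (K + 1) * (K : ℝ) ^ K := by
  rcases Nat.eq_zero_or_pos K with rfl | hK
  · simp
  have key : ∀ k : ℕ, ((k + 1).factorial : ℝ) * Real.exp 1 ^ (k + 1) ≤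
      Real.exp 1 * ((k : ℝ) + 1) ^ (k + 2) := by
    intro k
    induction k with
    | zero => simp
    | succ k ih =>
      have h1 : Real.exp 1 * ((k : ℝ) + 1) ^ (k + 2) ≤ ((k : ℝ) + 2) ^ (k + 2) := by
        have hk : (0 : ℝ) < k + 1 := by positivity
        have h2 : Real.exp 1 ≤ (((k : ℝ) + 2) / (k + 1)) ^ (k + 2) := by
          have h3 : (0 : ℝ) < ((k : ℝ) + 2) / (k + 1) := by positivity
          rw [← Real.log_le_log_iff (Real.exp_pos _) (by positivity), Real.log_exp, Real.log_pow]
          have h4 := Real.one_sub_inv_le_log_of_pos h3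
          rw [inv_div] at h4
          have h5 : 1 - ((k : ℝ) + 1) / (k + 2) = 1 / (k + 2) := by
            field_simp
            ring
          rw [h5] at h4
          have h6 : (0 : ℝ) < k + 2 := by positivity
          rw [div_le_iff₀ h6] at h4
          push_cast
          linarith
        rw [div_pow, le_div_iff₀ (by positivity)] at h2
        exact h2
      rw [Nat.factorial_succ (k + 1), pow_succ (Real.exp 1)]
      push_cast
      calc ((k : ℝ) + 1 + 1) * ((k + 1).factorial : ℝ) * (Real.exp 1 ^ (k + 1) * Real.exp 1)
          = ((k : ℝ) + 2) * Real.exp 1 * (((k + 1).factorial : ℝ) * Real.exp 1 ^ (k + 1)) := by ring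
        _ ≤ ((k : ℝ) + 2) * Real.exp 1 * (Real.exp 1 * ((k : ℝ) + 1) ^ (k + 2)) :=
          mul_le_mul_of_nonneg_left ih (by positivity)
        _ ≤ ((k : ℝ) + 2) * Real.exp 1 * ((k : ℝ) + 2) ^ (k + 2) :=
          mul_le_mul_of_nonneg_left h1 (by positivity)
        _ = Real.exp 1 * ((k : ℝ) + 1 + 1) ^ (k + 1 + 2) := by ring
  obtain ⟨k, rfl⟩ := Nat.exists_eq_succ_of_ne_zero hK.ne'
  refine (key k).trans ?_
  push_cast
  rw [mul_assoc, pow_succ' _ (k + 1)]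
  exact mul_le_mul_of_nonneg_left
    (mul_le_mul_of_nonneg_right (by linarith) (by positivity)) (Real.exp_pos _).le

theorem classCard_spinClass_swap (τ : Fin m × Bool → ℤˣ) (c : ℤˣ × ℤˣ) :
    classCard (spinClass τ) c.swap = classCard (spinClass τ) c := by
  unfold classCard
  refine Finset.card_bij (fun a _ => mate a) ?_ ?_ ?_
  · intro a ha
    rw [Finset.mem_filter] at ha ⊢
    refine ⟨Finset.mem_univ _, ?_⟩
    have h := ha.2
    unfold spinClass at h ⊢
    rw [mate_mate]
    exact (Prod.swap_injective (by simpa using h))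
  · intro a _ b _ h
    rw [← mate_mate a, h, mate_mate]
  · intro b hb
    refine ⟨mate b, ?_, mate_mate b⟩
    rw [Finset.mem_filter] at hb ⊢
    refine ⟨Finset.mem_univ _, ?_⟩
    rw [← hb.2]
    unfold spinClass
    rw [mate_mate]
    rfl

/-- The weight of an assignment of spins to the half-edges under a product measure on the edges. -/
noncomputable def typeWeight (q : ℤˣ × ℤˣ → ℝ) (τ : Fin m × Bool → ℤˣ) : ℝ :=
  ∏ k, q (τ (k, false), τ (k, true))

theorem sum_typeWeight (q : ℤˣ × ℤˣ → ℝ) (hq : ∑ c, q c = 1) :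
    ∑ τ : Fin m × Bool → ℤˣ, typeWeight q τ = 1 := by
  have h1 : ∑ g : Fin m → ℤˣ × ℤˣ, ∏ k, q (g k) = 1 := by
    have := Finset.prod_univ_sum (fun _ : Fin m => (Finset.univ : Finset (ℤˣ × ℤˣ))) fun _ c => q c
    rw [Fintype.piFinset_univ] at this
    rw [← this, hq]
    simp
  rw [← h1]
  let E : (Fin m × Bool → ℤˣ) ≃ (Fin m → ℤˣ × ℤˣ) :=
    { toFun := fun τ k => (τ (k, false), τ (k, true))
      invFun := fun g a => if a.2 then (g a.1).2 else (g a.1).1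
      left_inv := by
        intro τ
        funext ⟨k, b⟩
        cases b <;> simp
      right_inv := by
        intro g
        funext k
        simp }
  exact Fintype.sum_equiv E _ _ fun τ => rfl

/-- Every edge is seen from both of its ends, with swapped classes. -/
theorem typeWeight_sq (q : ℤˣ × ℤˣ → ℝ) (hq : ∀ c, q c.swap = q c) (τ : Fin m × Bool → ℤˣ) :
    typeWeight q τ ^ 2 = ∏ c, q c ^ classCard (spinClass τ) c := by
  rw [← prod_comp_eq_prod_pow_classCard, Fintype.prod_prod_type, typeWeight, ← Finset.prod_pow]
  refine Finset.prod_congr rfl fun k _ => ?_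
  rw [Fintype.prod_bool, sq]
  congr 1
  rw [← hq]
  rfl

/-- The proportion of vertices of spin `s`. -/
noncomputable def spinDensity (σ : Config n) (s : ℤˣ) : ℝ :=
  ((Finset.univ.filter fun v => σ v = s).card : ℝ) / n

theorem spinDensity_nonneg (σ : Config n) (s : ℤˣ) : 0 ≤ spinDensity σ s := by
  unfold spinDensity
  positivity

theorem sum_comp_spin (hn : 0 < n) (σ : Config n) (f : ℤˣ → ℝ) :
    ∑ v, f (σ v) = n * ∑ s, spinDensity σ s * f s := by
  have hn' : (n : ℝ) ≠ 0 := by exact_mod_cast hn.ne'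
  rw [← Finset.sum_fiberwise' Finset.univ σ f, Finset.mul_sum]
  refine Finset.sum_congr rfl fun s _ => ?_
  rw [Finset.sum_const, nsmul_eq_mul, spinDensity]
  field_simp

theorem sum_spinDensity (hn : 0 < n) (σ : Config n) : ∑ s, spinDensity σ s = 1 := by
  have hn' : (n : ℝ) ≠ 0 := by exact_mod_cast hn.ne'
  have h := sum_comp_spin hn σ fun _ => 1
  simp only [Finset.sum_const, Finset.card_univ, Fintype.card_fin, nsmul_eq_mul, mul_one] at h
  exact (mul_left_cancel₀ hn' (by rw [mul_one]; exact h)).symm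

theorem spinDensity_neg (hn : 0 < n) (σ : Config n) (s : ℤˣ) :
    spinDensity σ (-s) = 1 - spinDensity σ s := by
  have h := sum_spinDensity hn σ
  rw [units_sum s] at h
  linarith

/-- The exponential factor of a vertex whose neighbours have the opposite spin with probability `p`,
when the rates of the two kinds of half-edges are tilted by `a` and `b`. -/
noncomputable def vertexFactor (δ t D p a b : ℝ) : ℝ :=
  Real.exp (-(D / 2) * (p * (a - 1) ^ 2 + (1 - p) * (b - 1) ^ 2)) *
    (δ + poissonTail (D * p * a) (D * (1 - p) * b) t)

theorem vertexFactor_nonneg {δ : ℝ} (hδ : 0 ≤ δ) (t D p a b : ℝ) :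
    0 ≤ vertexFactor δ t D p a b :=
  mul_nonneg (Real.exp_pos _).le (add_nonneg hδ (poissonTail_nonneg _ _ _))

/-- `α c ^ 2` is the ratio of the actual size of a class to its mean under uniform edge ends. A
class of mean zero is empty, so division by zero does no harm. -/
theorem exists_tilt (hn : 0 < n) (hm : 0 < m) (σ : Config n) (e : Multigraph n m) :
    ∃ α : ℤˣ × ℤˣ → ℝ, (∀ c, 0 ≤ α c) ∧ (∀ c, α c.swap = α c) ∧
      ∀ c, (classCard (spinClass (σ ∘ e)) c : ℝ) =
        2 * m * (spinDensity σ c.1 * spinDensity σ c.2 * α c ^ 2) := by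
  have hm' : (0 : ℝ) < m := by exact_mod_cast hm
  have hn' : (0 : ℝ) < n := by exact_mod_cast hn
  refine ⟨fun c => Real.sqrt ((classCard (spinClass (σ ∘ e)) c : ℝ) /
    (2 * m * (spinDensity σ c.1 * spinDensity σ c.2))), fun c => Real.sqrt_nonneg _, fun c => ?_,
    fun c => ?_⟩
  · simp only [classCard_spinClass_swap, Prod.fst_swap, Prod.snd_swap]
    rw [mul_comm (spinDensity σ c.2)]
  · have hd : ∀ a, spinDensity σ (σ (e a)) ≠ 0 := by
      intro a
      unfold spinDensity
      have : 0 < (Finset.univ.filter fun v => σ v = σ (e a)).card :=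
        Finset.card_pos.2 ⟨e a, by simp⟩
      have : (0 : ℝ) < (Finset.univ.filter fun v => σ v = σ (e a)).card := by exact_mod_cast this
      positivity
    have h0 := mul_nonneg (spinDensity_nonneg σ c.1) (spinDensity_nonneg σ c.2)
    rw [Real.sq_sqrt (by positivity)]
    by_cases hz : spinDensity σ c.1 * spinDensity σ c.2 = 0
    · rw [hz]
      have : classCard (spinClass (σ ∘ e)) c = 0 := by
        unfold classCard
        rw [Finset.card_eq_zero, Finset.filter_eq_empty_iff]
        rintro a - h
        rw [← h] at hz
        exact (mul_ne_zero (hd a) (hd (mate a))) hz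
      simp [this]
    · have hz1 := left_ne_zero_of_mul hz
      have hz2 := right_ne_zero_of_mul hz
      field_simp

/-- With rates `ρ c = D * p c.2 * α c`, the factorials contribute `(2m/e)^(2m)` times the square of
the type weight, up to a polynomial, while the rates remove `D^(2m)` times one type weight. The
surviving single weight is a probability, which can be summed over `τ`. -/
theorem sum_type_le {δ : ℝ} (hδ : 0 ≤ δ) (t : ℝ) (hn : 0 < n) (hm : 0 < m) (σ : Config n)
    (K : ℤˣ × ℤˣ → ℕ) {α : ℤˣ × ℤˣ → ℝ} (hα : ∀ c, 0 ≤ α c) (hswap : ∀ c, α c.swap = α c)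
    (hK : ∀ c, (K c : ℝ) = 2 * m * (spinDensity σ c.1 * spinDensity σ c.2 * α c ^ 2))
    (τ : Fin m × Bool → ℤˣ) (hτ : classCard (spinClass τ) = K) :
    ∑ e : Multigraph n m with σ ∘ e = τ, ∏ v, softStep δ t (cutExcess e σ v) ≤
      (Real.exp 1 * (2 * m + 1)) ^ 4 * (n / Real.exp 1) ^ (2 * m) *
        typeWeight (fun c => spinDensity σ c.1 * spinDensity σ c.2 * α c ^ 2) τ *
        ∏ v, (Real.exp (2 * m / n * spinDensity σ (-σ v) * α (σ v, -σ v) +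
          2 * m / n * spinDensity σ (σ v) * α (σ v, σ v)) *
        (δ + poissonTail (2 * m / n * spinDensity σ (-σ v) * α (σ v, -σ v))
          (2 * m / n * spinDensity σ (σ v) * α (σ v, σ v)) t)) := by
  have hm' : (0 : ℝ) < m := by exact_mod_cast hm
  have hn' : (0 : ℝ) < n := by exact_mod_cast hn
  set D : ℝ := 2 * m / n with hD
  have hDpos : 0 < D := by positivity
  set p := spinDensity σ with hp
  have hp0 : ∀ s, 0 ≤ p s := spinDensity_nonneg σ
  set q : ℤˣ × ℤˣ → ℝ := fun c => p c.1 * p c.2 * α c ^ 2 with hq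
  have hq0 : ∀ c, 0 ≤ q c := fun c => mul_nonneg (mul_nonneg (hp0 _) (hp0 _)) (sq_nonneg _)
  have hqs : ∀ c, q c.swap = q c := fun c => by
    simp only [hq, Prod.fst_swap, Prod.snd_swap, hswap]
    ring
  let ρ : ℤˣ × ℤˣ → ℝ := fun c => D * p c.2 * α c
  have hρ : ∀ c, 0 ≤ ρ c := fun c => mul_nonneg (mul_nonneg hDpos.le (hp0 _)) (hα c)
  have hKs : ∀ c, K c.swap = K c := fun c => by rw [← hτ]; exact classCard_spinClass_swap τ c
  have hKsum : ∑ c, K c = 2 * m := by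
    rw [← hτ, sum_classCard]
    simp [mul_comm]
  have hw2 := typeWeight_sq q hqs τ
  rw [hτ] at hw2
  have hw0 : 0 ≤ typeWeight q τ := Finset.prod_nonneg fun k _ => hq0 _
  have hwpos : 0 < typeWeight q τ := by
    refine lt_of_le_of_ne hw0 fun h => ?_
    rw [← h] at hw2
    have hne : ∏ c, q c ^ K c ≠ 0 := Finset.prod_ne_zero_iff.2 fun c _ => by
      rcases Nat.eq_zero_or_pos (K c) with h0 | h0
      · rw [h0, pow_zero]
        exact one_ne_zero
      · refine pow_ne_zero _ fun hz => ?_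
        have h1 := hK c
        have h2 : p c.1 * p c.2 * α c ^ 2 = 0 := hz
        rw [h2, mul_zero] at h1
        exact h0.ne' (by exact_mod_cast h1)
    exact hne (by rw [← hw2]; norm_num)
  -- Proved for squares, pairing `c` with `c.swap`: the rates of the two classes multiply to `D ^ 2
  -- * q c`.
  have hρprod : ∏ c, ρ c ^ K c = D ^ (2 * m) * typeWeight q τ := by
    have hsq : (∏ c, ρ c ^ K c) ^ 2 = (D ^ (2 * m) * typeWeight q τ) ^ 2 := by
      have h1 : ∏ c : ℤˣ × ℤˣ, ρ c ^ K c = ∏ c : ℤˣ × ℤˣ, ρ c.swap ^ K c := by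
        rw [← Equiv.prod_comp (Equiv.prodComm ℤˣ ℤˣ)]
        refine Finset.prod_congr rfl fun c _ => ?_
        rw [Equiv.prodComm_apply, hKs]
      rw [sq]
      nth_rewrite 2 [h1]
      rw [← Finset.prod_mul_distrib, mul_pow, hw2, ← hKsum, ← Finset.prod_pow_eq_pow_sum,
        ← Finset.prod_pow, ← Finset.prod_mul_distrib]
      refine Finset.prod_congr rfl fun c _ => ?_
      rw [← mul_pow, ← pow_mul, mul_comm (K c) 2, pow_mul, ← mul_pow]
      congr 1
      simp only [ρ, hq, Prod.snd_swap, hswap]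
      ring
    exact (sq_eq_sq₀ (Finset.prod_nonneg fun c _ => pow_nonneg (hρ c) _)
      (mul_nonneg (pow_nonneg hDpos.le _) hw0)).1 hsq
  have hfact : ∏ c, ((K c).factorial : ℝ) ≤ (Real.exp 1 * (2 * m + 1)) ^ 4 *
      ((2 * m / Real.exp 1) ^ (2 * m) * typeWeight q τ ^ 2) := by
    have h1 : ∀ c, ((K c).factorial : ℝ) ≤
        Real.exp 1 * (2 * m + 1) * ((2 * m / Real.exp 1) ^ K c * q c ^ K c) := by
      intro c
      have h2 := factorial_mul_exp_le (K c)
      have h3 : (K c : ℝ) ≤ 2 * m := by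
        have : K c ≤ ∑ c, K c := Finset.single_le_sum (fun _ _ => Nat.zero_le _) (Finset.mem_univ c)
        rw [hKsum] at this
        exact_mod_cast this
      have h4 : (K c : ℝ) = 2 * m * q c := hK c
      have h5 : ((2 * m / Real.exp 1) ^ K c * q c ^ K c : ℝ) = (K c : ℝ) ^ K c / Real.exp 1 ^ K c := by
        rw [← mul_pow, ← div_pow]
        rw [h4]
        ring
      rw [h5, ← mul_div_assoc, le_div_iff₀ (by positivity)]
      refine h2.trans (mul_le_mul_of_nonneg_right ?_ (by positivity))
      exact mul_le_mul_of_nonneg_left (by linarith) (Real.exp_pos _).le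
    refine (Finset.prod_le_prod (fun c _ => by positivity) fun c _ => h1 c).trans_eq ?_
    rw [Finset.prod_mul_distrib, Finset.prod_const, Finset.prod_mul_distrib,
      Finset.prod_pow_eq_pow_sum, hKsum, hw2]
    simp
  have hmain := prod_pow_mul_sum_softStep_le hδ t σ τ hρ
  rw [hτ, hρprod] at hmain
  set Y := ∏ v, (Real.exp (ρ (σ v, -σ v) + ρ (σ v, σ v)) *
        (δ + poissonTail (ρ (σ v, -σ v)) (ρ (σ v, σ v)) t)) with hY
  have hY0 : 0 ≤ Y := Finset.prod_nonneg fun v _ =>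
    mul_nonneg (Real.exp_pos _).le (add_nonneg hδ (poissonTail_nonneg _ _ _))
  have hDw : 0 < D ^ (2 * m) * typeWeight q τ := mul_pos (pow_pos hDpos _) hwpos
  refine le_of_mul_le_mul_left (hmain.trans ((mul_le_mul_of_nonneg_right hfact hY0).trans_eq ?_)) hDw
  have hpow : D ^ (2 * m) * (n / Real.exp 1) ^ (2 * m) = (2 * m / Real.exp 1) ^ (2 * m) := by
    rw [← mul_pow, hD]
    congr 1
    field_simp
  rw [← hpow]
  ring

/-- Completing the square: the class proportions `p * p * α ^ 2` sum to `1`, so the Stirling factor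
`exp (-2m)` and the Poisson normalizations combine into the quadratic cost of each vertex. -/
theorem exp_neg_mul_prod_eq {δ : ℝ} (t : ℝ) (hn : 0 < n) (hm : 0 < m) (σ : Config n)
    (τ : Fin m × Bool → ℤˣ) {α : ℤˣ × ℤˣ → ℝ}
    (hK : ∀ c, (classCard (spinClass τ) c : ℝ) =
      2 * m * (spinDensity σ c.1 * spinDensity σ c.2 * α c ^ 2)) :
    (n / Real.exp 1) ^ (2 * m) *
        ∏ v, (Real.exp (2 * m / n * spinDensity σ (-σ v) * α (σ v, -σ v) +
          2 * m / n * spinDensity σ (σ v) * α (σ v, σ v)) *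
        (δ + poissonTail (2 * m / n * spinDensity σ (-σ v) * α (σ v, -σ v))
          (2 * m / n * spinDensity σ (σ v) * α (σ v, σ v)) t)) =
      (n : ℝ) ^ (2 * m) * ∏ v, vertexFactor δ t (2 * m / n) (spinDensity σ (-σ v))
        (α (σ v, -σ v)) (α (σ v, σ v)) := by
  have hm' : (0 : ℝ) < m := by exact_mod_cast hm
  have hn' : (0 : ℝ) < n := by exact_mod_cast hn
  set D : ℝ := 2 * m / n with hD
  have hDn : n * D = 2 * m := by rw [hD]; field_simp
  set p := spinDensity σ with hp
  have hneg : ∀ s, p (-s) = 1 - p s := spinDensity_neg hn σ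
  have hsum : ∑ c : ℤˣ × ℤˣ, p c.1 * p c.2 * α c ^ 2 = 1 := by
    have h1 : ((∑ c, classCard (spinClass τ) c : ℕ) : ℝ) = 2 * m := by
      rw [sum_classCard]
      simp [mul_comm]
    push_cast at h1
    simp_rw [hK] at h1
    rw [← Finset.mul_sum] at h1
    exact mul_left_cancel₀ (by positivity : (2 * m : ℝ) ≠ 0) (by rw [h1, mul_one])
  rw [Fintype.sum_prod_type, units_sum 1, units_sum 1, units_sum 1, hneg] at hsum
  have hexp : -(2 * m : ℝ) + ∑ v, (D * p (-σ v) * α (σ v, -σ v) + D * p (σ v) * α (σ v, σ v)) =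
      ∑ v, -(D / 2) * (p (-σ v) * (α (σ v, -σ v) - 1) ^ 2 +
        (1 - p (-σ v)) * (α (σ v, σ v) - 1) ^ 2) := by
    rw [sum_comp_spin hn σ fun s => D * p (-s) * α (s, -s) + D * p s * α (s, s),
      sum_comp_spin hn σ fun s => -(D / 2) * (p (-s) * (α (s, -s) - 1) ^ 2 +
        (1 - p (-s)) * (α (s, s) - 1) ^ 2), ← hp, units_sum 1, units_sum 1]
    simp only [hneg, neg_neg]
    linear_combination (n * D / 2) * hsum + hDn
  have h2 : (n / Real.exp 1 : ℝ) ^ (2 * m) = (n : ℝ) ^ (2 * m) * Real.exp (-(2 * m : ℝ)) := by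
    rw [div_pow, div_eq_mul_inv, Real.exp_neg, ← Real.exp_nat_mul]
    push_cast
    rw [mul_one]
  unfold vertexFactor
  have h3 : ∀ v, 1 - p (-σ v) = p (σ v) := fun v => by rw [hneg]; ring
  rw [Finset.prod_mul_distrib, Finset.prod_mul_distrib, ← Real.exp_sum, ← Real.exp_sum, h2,
    ← hexp, Real.exp_add]
  simp only [h3]
  ring

theorem exists_sum_classCard_eq_le {δ : ℝ} (hδ : 0 ≤ δ) (t : ℝ) (hn : 0 < n) (hm : 0 < m)
    (σ : Config n) (K : ℤˣ × ℤˣ → ℕ) :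
    ∃ α : ℤˣ × ℤˣ → ℝ, (∀ c, 0 ≤ α c) ∧
      ∑ e : Multigraph n m with classCard (spinClass (σ ∘ e)) = K,
        ∏ v, softStep δ t (cutExcess e σ v) ≤
      (Real.exp 1 * (2 * m + 1)) ^ 4 * ((n : ℝ) ^ (2 * m) *
        ∏ v, vertexFactor δ t (2 * m / n) (spinDensity σ (-σ v))
          (α (σ v, -σ v)) (α (σ v, σ v))) := by
  by_cases hex : ∃ e₀ : Multigraph n m, classCard (spinClass (σ ∘ e₀)) = K
  swap
  · refine ⟨fun _ => 1, fun _ => zero_le_one, ?_⟩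
    have hempty : (Finset.univ.filter fun e : Multigraph n m =>
        classCard (spinClass (σ ∘ e)) = K) = ∅ :=
      Finset.filter_eq_empty_iff.2 fun e _ h => hex ⟨e, h⟩
    rw [hempty, Finset.sum_empty]
    exact mul_nonneg (by positivity) (mul_nonneg (by positivity)
      (Finset.prod_nonneg fun v _ => vertexFactor_nonneg hδ _ _ _ _ _))
  obtain ⟨e₀, he₀⟩ := hex
  obtain ⟨α, hα, hswap, hK⟩ := exists_tilt hn hm σ e₀
  refine ⟨α, hα, ?_⟩
  rw [← exp_neg_mul_prod_eq t hn hm σ (σ ∘ e₀) hK]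
  rw [he₀] at hK
  set q : ℤˣ × ℤˣ → ℝ := fun c => spinDensity σ c.1 * spinDensity σ c.2 * α c ^ 2 with hq
  have hq0 : ∀ c, 0 ≤ q c := fun c => mul_nonneg
    (mul_nonneg (spinDensity_nonneg σ _) (spinDensity_nonneg σ _)) (sq_nonneg _)
  have hm' : (0 : ℝ) < m := by exact_mod_cast hm
  have hqsum : ∑ c, q c = 1 := by
    have h1 : ((∑ c, classCard (spinClass (σ ∘ e₀)) c : ℕ) : ℝ) = 2 * m := by
      rw [sum_classCard]
      simp [mul_comm]
    rw [he₀] at h1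
    push_cast at h1
    simp_rw [hK] at h1
    rw [← Finset.mul_sum] at h1
    exact mul_left_cancel₀ (by positivity : (2 * m : ℝ) ≠ 0) (by rw [h1, mul_one])
  set Y := ∏ v, (Real.exp (2 * m / n * spinDensity σ (-σ v) * α (σ v, -σ v) +
          2 * m / n * spinDensity σ (σ v) * α (σ v, σ v)) *
        (δ + poissonTail (2 * m / n * spinDensity σ (-σ v) * α (σ v, -σ v))
          (2 * m / n * spinDensity σ (σ v) * α (σ v, σ v)) t)) with hY
  have hY0 : 0 ≤ Y := Finset.prod_nonneg fun v _ =>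
    mul_nonneg (Real.exp_pos _).le (add_nonneg hδ (poissonTail_nonneg _ _ _))
  set A : ℝ := (Real.exp 1 * (2 * m + 1)) ^ 4 * (n / Real.exp 1) ^ (2 * m) with hA
  have hA0 : 0 ≤ A := by positivity
  have hfib : ∑ e : Multigraph n m with classCard (spinClass (σ ∘ e)) = K,
      ∏ v, softStep δ t (cutExcess e σ v) =
      ∑ τ : Fin m × Bool → ℤˣ with classCard (spinClass τ) = K,
        ∑ e : Multigraph n m with σ ∘ e = τ, ∏ v, softStep δ t (cutExcess e σ v) := by
    rw [← Finset.sum_fiberwise_of_maps_to (g := fun e : Multigraph n m => σ ∘ e)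
      (t := Finset.univ.filter fun τ : Fin m × Bool → ℤˣ => classCard (spinClass τ) = K)
      (fun e he => Finset.mem_filter.2 ⟨Finset.mem_univ _, (Finset.mem_filter.1 he).2⟩)]
    refine Finset.sum_congr rfl fun τ hτ => ?_
    rw [Finset.filter_filter]
    refine Finset.sum_congr (Finset.filter_congr fun e _ => ?_) fun _ _ => rfl
    refine ⟨fun h => h.2, fun h => ⟨?_, h⟩⟩
    rw [h]
    exact (Finset.mem_filter.1 hτ).2
  rw [hfib]
  calc ∑ τ : Fin m × Bool → ℤˣ with classCard (spinClass τ) = K,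
        ∑ e : Multigraph n m with σ ∘ e = τ, ∏ v, softStep δ t (cutExcess e σ v)
      ≤ ∑ τ : Fin m × Bool → ℤˣ with classCard (spinClass τ) = K, A * typeWeight q τ * Y :=
        Finset.sum_le_sum fun τ hτ =>
          sum_type_le hδ t hn hm σ K hα hswap hK τ (Finset.mem_filter.1 hτ).2
    -- The sum is extended to all spin patterns, whose weights total `1`; counting the patterns of
    -- type `K` therefore costs nothing.
    _ ≤ ∑ τ : Fin m × Bool → ℤˣ, A * typeWeight q τ * Y :=
        Finset.sum_le_sum_of_subset_of_nonneg (Finset.filter_subset _ _) fun τ _ _ =>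
          mul_nonneg (mul_nonneg hA0 (Finset.prod_nonneg fun k _ => hq0 _)) hY0
    _ = A * Y := by
        rw [← Finset.sum_mul, ← Finset.mul_sum, sum_typeWeight q hqsum, mul_one]
    _ = _ := by rw [hA]; ring

end TypeCounting

/-! ### Gaussian bounds for the vertex factors and their product. -/

section GaussianLimit

theorem poissonTail_eq (x u t : ℝ) (hx : 0 ≤ x) (hu : 0 ≤ u) {s : ℝ} (hs : 0 < s) :
    poissonTail x u t =
      (poissonDiff x.toNNReal u.toNNReal s).real (Set.Ici ((t - (x - u)) / s)) := by
  unfold poissonTail poissonDiff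
  rw [MeasureTheory.map_measureReal_apply (measurable_poissonDiff_fun _ _ _) measurableSet_Ici]
  congr 1
  ext p
  simp only [Set.mem_ofPred_eq, Set.mem_preimage, Set.mem_Ici, Real.coe_toNNReal _ hx,
    Real.coe_toNNReal _ hu]
  rw [div_le_div_iff_of_pos_right hs]
  constructor <;> intro h <;> linarith

/-- Either the tilting cost alone makes the factor at most `η`, or the tilts are of order `1 / √D`
and the uniform central limit theorem applies. The `y` is the shift of the standardized mean caused
by the tilt, and convexity bounds `y ^ 2` by the cost. -/
theorem exists_vertexFactor_le (h : ℝ) {η : ℝ} (hη : 0 < η) (hη1 : η ≤ 1) :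
    ∃ D₀ : ℝ, ∀ D, D₀ ≤ D → 0 < D → ∀ p, 0 ≤ p → p ≤ 1 → ∀ a b, 0 ≤ a → 0 ≤ b → ∃ y,
      vertexFactor (η / 2) (h * Real.sqrt D) D p a b ≤
        η + Real.exp (-y ^ 2) * gcdf (y + Real.sqrt (D / 2) * (2 * p - 1) - h / Real.sqrt 2) := by
  set M := Real.log (2 / η) with hM
  have hexpM : Real.exp (-M) = η / 2 := by
    rw [hM, Real.exp_neg, Real.exp_log (by positivity), inv_div]
  have hM0 : 0 ≤ M := Real.log_nonneg (by rw [le_div_iff₀ hη]; linarith)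
  obtain ⟨D₀, hD₀⟩ := exists_poissonDiff_tail_le (Real.sqrt (2 * M)) (half_pos hη)
  refine ⟨D₀, fun D hD hDpos p hp0 hp1 a b ha hb => ?_⟩
  have hp1' : 0 ≤ 1 - p := by linarith
  set κ := p * (a - 1) ^ 2 + (1 - p) * (b - 1) ^ 2 with hκ
  have hκ0 : 0 ≤ κ := add_nonneg (mul_nonneg hp0 (sq_nonneg _)) (mul_nonneg hp1' (sq_nonneg _))
  set P := poissonTail (D * p * a) (D * (1 - p) * b) (h * Real.sqrt D) with hP
  have hvf : vertexFactor (η / 2) (h * Real.sqrt D) D p a b =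
      Real.exp (-(D / 2) * κ) * (η / 2 + P) := rfl
  rw [hvf]
  rcases le_or_gt M (D / 2 * κ) with hlarge | hsmall
  · refine ⟨0, ?_⟩
    have h1 : Real.exp (-(D / 2) * κ) ≤ η / 2 := by
      rw [← hexpM]
      exact Real.exp_le_exp.2 (by linarith)
    have h2 : P ≤ 1 := poissonTail_le_one _ _ _
    have h3 : 0 ≤ P := poissonTail_nonneg _ _ _
    have h4 : Real.exp (-(D / 2) * κ) * (η / 2 + P) ≤ η / 2 * 2 :=
      mul_le_mul h1 (by linarith) (by linarith) (by linarith)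
    have h5 := gcdf_pos (0 + Real.sqrt (D / 2) * (2 * p - 1) - h / Real.sqrt 2)
    have h6 := mul_pos (Real.exp_pos (-(0 : ℝ) ^ 2)) h5
    linarith
  · set x := D * p * a with hx
    set u := D * (1 - p) * b with hu
    have hx0 : 0 ≤ x := mul_nonneg (mul_nonneg hDpos.le hp0) ha
    have hu0 : 0 ≤ u := mul_nonneg (mul_nonneg hDpos.le hp1') hb
    have hs : 0 < Real.sqrt (2 * D) := Real.sqrt_pos.2 (by positivity)
    have hdev : |((x.toNNReal : NNReal) : ℝ) + (u.toNNReal : NNReal) - D| ≤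
        Real.sqrt (2 * M) * Real.sqrt D := by
      rw [Real.coe_toNNReal _ hx0, Real.coe_toNNReal _ hu0, ← Real.sqrt_mul (by positivity)]
      refine Real.abs_le_sqrt ?_
      have e : x + u - D = D * (p * (a - 1) + (1 - p) * (b - 1)) := by rw [hx, hu]; ring
      have h1 : (p * (a - 1) + (1 - p) * (b - 1)) ^ 2 ≤ κ := by
        rw [hκ]
        nlinarith [mul_nonneg (mul_nonneg hp0 hp1') (sq_nonneg ((a - 1) - (b - 1)))]
      rw [e, mul_pow]
      have h2 : D * κ ≤ 2 * M := by linarith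
      nlinarith [mul_le_mul_of_nonneg_left h1 (sq_nonneg D), mul_le_mul_of_nonneg_left h2 hDpos.le]
    set y := Real.sqrt (D / 2) * (p * (a - 1) - (1 - p) * (b - 1)) with hy
    refine ⟨y, ?_⟩
    have htail := hD₀ D hD x.toNNReal u.toNNReal hdev ((h * Real.sqrt D - (x - u)) / Real.sqrt (2 * D))
    rw [← poissonTail_eq x u _ hx0 hu0 hs] at htail
    have harg : -((h * Real.sqrt D - (x - u)) / Real.sqrt (2 * D)) =
        y + Real.sqrt (D / 2) * (2 * p - 1) - h / Real.sqrt 2 := by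
      have hsD : 0 < Real.sqrt D := Real.sqrt_pos.2 hDpos
      have hs2 : 0 < Real.sqrt 2 := by positivity
      rw [hy, hx, hu, Real.sqrt_mul (by norm_num), Real.sqrt_div hDpos.le]
      have hDD : D = Real.sqrt D * Real.sqrt D := (Real.mul_self_sqrt hDpos.le).symm
      field_simp
      linear_combination (p * a - (1 - p) * b) * hDD
    rw [harg] at htail
    have hcost : Real.exp (-(D / 2) * κ) ≤ Real.exp (-y ^ 2) := by
      refine Real.exp_le_exp.2 ?_
      rw [hy, mul_pow, Real.sq_sqrt (by positivity)]
      have h1 : (p * (a - 1) - (1 - p) * (b - 1)) ^ 2 ≤ κ := by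
        rw [hκ]
        nlinarith [mul_nonneg (mul_nonneg hp0 hp1') (sq_nonneg ((a - 1) + (b - 1)))]
      nlinarith [mul_le_mul_of_nonneg_left h1 (by positivity : 0 ≤ D / 2)]
    set g := gcdf (y + Real.sqrt (D / 2) * (2 * p - 1) - h / Real.sqrt 2) with hg
    have hg0 : 0 < g := gcdf_pos _
    have h1 : Real.exp (-(D / 2) * κ) ≤ 1 := Real.exp_le_one_iff.2 (by
      have := mul_nonneg (half_pos hDpos).le hκ0
      linarith)
    calc Real.exp (-(D / 2) * κ) * (η / 2 + P)
        ≤ Real.exp (-(D / 2) * κ) * (η + g) :=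
          mul_le_mul_of_nonneg_left (by linarith) (Real.exp_pos _).le
      _ = Real.exp (-(D / 2) * κ) * η + Real.exp (-(D / 2) * κ) * g := by ring
      _ ≤ η + Real.exp (-y ^ 2) * g :=
          add_le_add (mul_le_of_le_one_left hη.le h1) (mul_le_mul_of_nonneg_right hcost hg0.le)

theorem gaussian_factor_le_one (y z : ℝ) : Real.exp (-y ^ 2) * gcdf z ≤ 1 := by
  have h1 : Real.exp (-y ^ 2) ≤ 1 := Real.exp_le_one_iff.2 (by nlinarith [sq_nonneg y])
  have h2 := gcdf_lt_one z
  have h3 := gcdf_pos z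
  have h4 := Real.exp_pos (-y ^ 2)
  nlinarith

theorem gaussian_factor_le {h s : ℝ} (hs : s ≤ 0) (y : ℝ) :
    Real.exp (-y ^ 2) * gcdf (y + s - h / Real.sqrt 2) ≤ Real.exp (w h) / 2 :=
  (mul_le_mul_of_nonneg_left (strictMono_gcdf.monotone (by linarith)) (Real.exp_pos _).le).trans
    (exp_neg_sq_mul_gcdf_le h y)

/-- The opposite shifts `s` and `-s` cancel at the midpoint: log-concavity of `gcdf` and convexity
of the square reduce the product to one factor at `(y + z) / 2`, squared. -/
theorem gaussian_factor_mul_le (h s y z : ℝ) :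
    (Real.exp (-y ^ 2) * gcdf (y + s - h / Real.sqrt 2)) *
      (Real.exp (-z ^ 2) * gcdf (z - s - h / Real.sqrt 2)) ≤ (Real.exp (w h) / 2) ^ 2 := by
  have h1 := gcdf_mul_gcdf_le (y + s - h / Real.sqrt 2) (z - s - h / Real.sqrt 2)
  have e : (y + s - h / Real.sqrt 2 + (z - s - h / Real.sqrt 2)) / 2 =
      (y + z) / 2 - h / Real.sqrt 2 := by ring
  rw [e] at h1
  have h2 : Real.exp (-y ^ 2) * Real.exp (-z ^ 2) ≤ Real.exp (-((y + z) / 2) ^ 2) ^ 2 := by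
    rw [← Real.exp_add, ← Real.exp_nat_mul]
    refine Real.exp_le_exp.2 ?_
    push_cast
    nlinarith [sq_nonneg (y - z)]
  calc _ = (Real.exp (-y ^ 2) * Real.exp (-z ^ 2)) *
        (gcdf (y + s - h / Real.sqrt 2) * gcdf (z - s - h / Real.sqrt 2)) := by ring
    _ ≤ Real.exp (-((y + z) / 2) ^ 2) ^ 2 * gcdf ((y + z) / 2 - h / Real.sqrt 2) ^ 2 :=
        mul_le_mul h2 h1 (mul_pos (gcdf_pos _) (gcdf_pos _)).le (by positivity)
    _ = (Real.exp (-((y + z) / 2) ^ 2) * gcdf ((y + z) / 2 - h / Real.sqrt 2)) ^ 2 := by ring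
    _ ≤ _ := pow_le_pow_left₀ (mul_pos (Real.exp_pos _) (gcdf_pos _)).le
        (exp_neg_sq_mul_gcdf_le h _) 2

/-- Each minority vertex is paired with a majority one, so `B` alone may exceed `β`. -/
theorem pow_mul_pow_le {A B β : ℝ} (hA : 0 ≤ A) (hB : 0 ≤ B) (hAβ : A ≤ β)
    (hAB : A * B ≤ β ^ 2) {k l : ℕ} (hlk : l ≤ k) : A ^ k * B ^ l ≤ β ^ (k + l) := by
  obtain ⟨j, rfl⟩ := Nat.exists_eq_add_of_le hlk
  calc A ^ (l + j) * B ^ l = (A * B) ^ l * A ^ j := by ring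
    _ ≤ (β ^ 2) ^ l * β ^ j := mul_le_mul (pow_le_pow_left₀ (mul_nonneg hA hB) hAB l)
        (pow_le_pow_left₀ hA hAβ j) (pow_nonneg hA j) (by positivity)
    _ = β ^ (l + j + l) := by ring

theorem exists_prod_vertexFactor_le {h : ℝ} (hw : w h < 0) {η : ℝ} (hη : 0 < η) (hη1 : η ≤ 1) :
    ∃ D₀ : ℝ, ∀ D, D₀ ≤ D → 0 < D → ∀ n : ℕ, 0 < n → ∀ σ : Config n, ∀ α : ℤˣ × ℤˣ → ℝ,
      (∀ c, 0 ≤ α c) →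
      ∏ v, vertexFactor (η / 2) (h * Real.sqrt D) D (spinDensity σ (-σ v))
          (α (σ v, -σ v)) (α (σ v, σ v)) ≤
        Real.sqrt ((Real.exp (w h) / 2) ^ 2 + 3 * η) ^ n := by
  obtain ⟨D₀, hD₀⟩ := exists_vertexFactor_le h hη hη1
  refine ⟨D₀, fun D hD hDpos n hn σ α hα => ?_⟩
  have hn' : (0 : ℝ) < n := by exact_mod_cast hn
  -- The slack `3 * η` absorbs the error terms of `(η + E) * (η + F)`, as `E`, `F` and `η` are at
  -- most `1`.
  set β := Real.sqrt ((Real.exp (w h) / 2) ^ 2 + 3 * η) with hβ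
  have hβ2 : β ^ 2 = (Real.exp (w h) / 2) ^ 2 + 3 * η := Real.sq_sqrt (by positivity)
  set ϱ := Real.exp (w h) / 2 with hϱ
  have hϱ0 : 0 < ϱ := by positivity
  have hϱ1 : ϱ ≤ 1 := by
    have := Real.exp_lt_one_iff.2 hw
    rw [hϱ]
    linarith
  let c : ℤˣ → ℕ := fun s => (Finset.univ.filter fun v => σ v = s).card
  let J : ℤˣ → ℝ := fun s => vertexFactor (η / 2) (h * Real.sqrt D) D (spinDensity σ (-s))
          (α (s, -s)) (α (s, s))
  have hJ0 : ∀ s, 0 ≤ J s := fun s => vertexFactor_nonneg (by positivity) _ _ _ _ _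
  have hprod : ∏ v, J (σ v) = ∏ s, J s ^ c s := by
    rw [← Finset.prod_fiberwise' Finset.univ σ J]
    simp [c]
  have hcsum : ∑ s, c s = n := by
    have := Finset.card_eq_sum_card_fiberwise (s := Finset.univ) (t := Finset.univ) (f := σ)
      fun v _ => Finset.mem_univ (σ v)
    rw [Finset.card_univ, Fintype.card_fin] at this
    exact this.symm
  obtain ⟨s, hs⟩ : ∃ s, c (-s) ≤ c s := by
    rcases le_total (c (-1)) (c 1) with h1 | h1
    · exact ⟨1, h1⟩
    · exact ⟨-1, by rwa [neg_neg]⟩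
  change ∏ v, J (σ v) ≤ _
  rw [hprod, units_prod s, mul_comm]
  rw [units_sum s, add_comm] at hcsum
  have hdens : spinDensity σ (-s) ≤ spinDensity σ s := by
    unfold spinDensity
    exact div_le_div_of_nonneg_right (by exact_mod_cast hs) hn'.le
  have hneg := spinDensity_neg hn σ s
  have hp0 := spinDensity_nonneg σ s
  have hp0' := spinDensity_nonneg σ (-s)
  obtain ⟨y, hy⟩ := hD₀ D hD hDpos (spinDensity σ (-s)) hp0' (by linarith) (α (s, -s)) (α (s, s))
    (hα _) (hα _)
  obtain ⟨z, hz⟩ := hD₀ D hD hDpos (spinDensity σ (-(-s))) (by rw [neg_neg]; exact hp0)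
    (by rw [neg_neg]; linarith) (α (-s, -(-s))) (α (-s, -s)) (hα _) (hα _)
  set S := Real.sqrt (D / 2) * (2 * spinDensity σ (-s) - 1) with hS
  have hS0 : S ≤ 0 := mul_nonpos_of_nonneg_of_nonpos (Real.sqrt_nonneg _) (by linarith)
  have hS' : z + Real.sqrt (D / 2) * (2 * spinDensity σ (-(-s)) - 1) - h / Real.sqrt 2 =
      z - S - h / Real.sqrt 2 := by
    rw [hS, neg_neg, hneg]
    ring
  rw [hS'] at hz
  have hA1 := gaussian_factor_le (h := h) hS0 y
  have hA2 := gaussian_factor_le_one y (y + S - h / Real.sqrt 2)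
  have hB2 := gaussian_factor_le_one z (z - S - h / Real.sqrt 2)
  have hAB := gaussian_factor_mul_le h S y z
  rw [← hϱ] at hA1 hAB
  set E := Real.exp (-y ^ 2) * gcdf (y + S - h / Real.sqrt 2) with hE
  set F := Real.exp (-z ^ 2) * gcdf (z - S - h / Real.sqrt 2) with hF
  have hE0 : 0 ≤ E := (mul_pos (Real.exp_pos _) (gcdf_pos _)).le
  have hF0 : 0 ≤ F := (mul_pos (Real.exp_pos _) (gcdf_pos _)).le
  have hJs : J s ≤ η + E := hy
  have hJs' : J (-s) ≤ η + F := hz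
  rw [← hcsum]
  refine pow_mul_pow_le (hJ0 _) (hJ0 _) ?_ ?_ hs
  · refine Real.le_sqrt_of_sq_le ?_
    have h1 : J s ≤ η + ϱ := hJs.trans (by linarith)
    calc J s ^ 2 ≤ (η + ϱ) ^ 2 := pow_le_pow_left₀ (hJ0 _) h1 2
      _ ≤ ϱ ^ 2 + 3 * η := by nlinarith
  · rw [hβ2]
    calc J s * J (-s) ≤ (η + E) * (η + F) := mul_le_mul hJs hJs' (hJ0 _) (by linarith)
      _ ≤ ϱ ^ 2 + 3 * η := by nlinarith

end GaussianLimit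

/-! ### The exponential bound for the first moment. -/

section FirstMoment

theorem rate_le_of_le_exp {n : ℕ} (hn : 0 < n) {a c : ℝ} (ha : a ≤ Real.exp (-c * n)) :
    rate n a ≤ ((-c : ℝ) : EReal) := by
  have hn' : (0 : ℝ) < n := by exact_mod_cast hn
  have hnE : (0 : EReal) < (n : EReal) := by exact_mod_cast hn'
  unfold rate
  rw [EReal.div_le_iff_le_mul hnE (EReal.natCast_ne_top n)]
  refine (ENNReal.log_le_log (ENNReal.ofReal_le_ofReal ha)).trans ?_
  rw [ENNReal.log_ofReal_of_pos (Real.exp_pos _), Real.log_exp]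
  refine le_of_eq ?_
  rw [mul_comm]
  push_cast
  rfl

theorem Xcut_le_X {n m : ℕ} (d z h r : ℝ) (e : Multigraph n m) : Xcut d z h r e ≤ X d h r e :=
  Finset.card_le_card fun σ hσ => by
    simp only [Finset.mem_filter] at hσ ⊢
    exact ⟨hσ.1, hσ.2.2⟩

theorem expect_mono {n m : ℕ} {f g : Multigraph n m → ℕ} (hfg : ∀ e, f e ≤ g e) :
    expect n m f ≤ expect n m g := by
  unfold expect
  exact div_le_div_of_nonneg_right
    (Finset.sum_le_sum fun e _ => by exact_mod_cast hfg e) (Nat.cast_nonneg _)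

/-- At most `(1 - r) n` vertices are unstable, and each costs at most a factor `δ`. Since `h > 0`,
replacing `d` by the true mean degree `2m/n ≤ d` only lowers the threshold. -/
theorem one_le_rpow_mul_prod_softStep {n m : ℕ} {d h r δ : ℝ} (hd : 0 < d) (hh : 0 < h)
    (hδ : 0 < δ) (hδ1 : δ ≤ 1) (hmd : (2 * m : ℝ) / n ≤ d) (e : Multigraph n m) (σ : Config n)
    (hσ : r * n ≤ numStable d h (weight e) σ) :
    1 ≤ (δ ^ (-(1 - r))) ^ n *
      ∏ v, softStep δ (h * Real.sqrt (2 * m / n)) (cutExcess e σ v) := by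
  classical
  set N := numStable d h (weight e) σ with hN
  have hNn : N ≤ n := by
    have := Finset.card_le_univ (Finset.univ.filter fun v => IsStable d h (weight e) σ v)
    rw [Fintype.card_fin] at this
    exact this
  have hstab : ∀ v, IsStable d h (weight e) σ v →
      h * Real.sqrt (2 * m / n) ≤ cutExcess e σ v := by
    intro v hv
    unfold IsStable at hv
    have hsd : 0 < Real.sqrt d := Real.sqrt_pos.2 hd
    rw [stability_weight, one_div, inv_mul_eq_div, le_div_iff₀ hsd] at hv
    exact (mul_le_mul_of_nonneg_left (Real.sqrt_le_sqrt hmd) hh.le).trans hv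
  have hprod : δ ^ (n - N) ≤ ∏ v, softStep δ (h * Real.sqrt (2 * m / n)) (cutExcess e σ v) := by
    have h1 : ∏ v : Fin n, (if IsStable d h (weight e) σ v then 1 else δ) = δ ^ (n - N) := by
      rw [Finset.prod_ite]
      simp only [Finset.prod_const_one, one_mul, Finset.prod_const]
      congr 1
      have h2 := Finset.card_filter_add_card_filter_not (s := (Finset.univ : Finset (Fin n)))
        (fun v => IsStable d h (weight e) σ v)
      rw [Finset.card_univ, Fintype.card_fin] at h2
      have h3 : N = (Finset.univ.filter fun v => IsStable d h (weight e) σ v).card := by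
        rw [hN, numStable]
      omega
    rw [← h1]
    refine Finset.prod_le_prod (fun v _ => ?_) fun v _ => ?_
    · split_ifs <;> linarith
    · unfold softStep
      by_cases hv : IsStable d h (weight e) σ v
      · rw [if_pos hv, if_pos (hstab v hv)]
        linarith
      · rw [if_neg hv]
        split_ifs <;> linarith
  have hpow : (δ ^ (-(1 - r))) ^ n = δ ^ (-((1 - r) * n)) := by
    rw [← Real.rpow_natCast, ← Real.rpow_mul hδ.le]
    congr 1
    ring
  rw [hpow]
  calc (1 : ℝ) = δ ^ (-((1 - r) * n)) * δ ^ ((1 - r) * n) := by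
        rw [← Real.rpow_add hδ, neg_add_cancel, Real.rpow_zero]
    _ ≤ δ ^ (-((1 - r) * n)) * δ ^ (((n - N : ℕ) : ℝ)) := by
        refine mul_le_mul_of_nonneg_left ?_ (Real.rpow_nonneg hδ.le _)
        refine Real.rpow_le_rpow_of_exponent_ge hδ hδ1 ?_
        rw [Nat.cast_sub hNn]
        linarith
    _ ≤ _ := by
        rw [Real.rpow_natCast]
        exact mul_le_mul_of_nonneg_left hprod (Real.rpow_nonneg hδ.le _)

theorem sum_prod_softStep_le {n m : ℕ} {δ t β : ℝ} (hδ : 0 ≤ δ) (hn : 0 < n) (hm : 0 < m)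
    (σ : Config n)
    (hβ : ∀ α : ℤˣ × ℤˣ → ℝ, (∀ c, 0 ≤ α c) →
      ∏ v, vertexFactor δ t (2 * m / n) (spinDensity σ (-σ v))
          (α (σ v, -σ v)) (α (σ v, σ v)) ≤ β ^ n) :
    ∑ e : Multigraph n m, ∏ v, softStep δ t (cutExcess e σ v) ≤
      Real.exp 1 ^ 4 * (2 * m + 1) ^ 8 * ((n : ℝ) ^ (2 * m) * β ^ n) := by
  have hmaps : ∀ e ∈ (Finset.univ : Finset (Multigraph n m)), classCard (spinClass (σ ∘ e)) ∈
      Fintype.piFinset fun _ : ℤˣ × ℤˣ => Finset.range (2 * m + 1) := by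
    intro e _
    refine Fintype.mem_piFinset.2 fun c => Finset.mem_range.2 (Nat.lt_succ_of_le ?_)
    refine (Finset.card_le_univ _).trans_eq ?_
    simp [mul_comm]
  rw [← Finset.sum_fiberwise_of_maps_to hmaps]
  have hterm : ∀ K ∈ Fintype.piFinset fun _ : ℤˣ × ℤˣ => Finset.range (2 * m + 1),
      ∑ e : Multigraph n m with classCard (spinClass (σ ∘ e)) = K,
        ∏ v, softStep δ t (cutExcess e σ v) ≤
      (Real.exp 1 * (2 * m + 1)) ^ 4 * ((n : ℝ) ^ (2 * m) * β ^ n) := by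
    intro K _
    obtain ⟨α, hα, hle⟩ := exists_sum_classCard_eq_le hδ t hn hm σ K
    exact hle.trans (mul_le_mul_of_nonneg_left
      (mul_le_mul_of_nonneg_left (hβ α hα) (by positivity)) (by positivity))
  refine (Finset.sum_le_card_nsmul _ _ _ hterm).trans_eq ?_
  rw [Fintype.card_piFinset, nsmul_eq_mul]
  simp only [Finset.card_range, Finset.prod_const, Finset.card_univ, Fintype.card_prod,
    Fintype.card_units_int]
  push_cast
  ring

theorem expect_X_le {n m : ℕ} {d h r δ β : ℝ} (hn : 0 < n) (hm : 0 < m) (hd : 0 < d) (hh : 0 < h)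
    (hδ : 0 < δ) (hδ1 : δ ≤ 1) (hmd : (2 * m : ℝ) / n ≤ d)
    (hβ : ∀ σ : Config n, ∀ α : ℤˣ × ℤˣ → ℝ, (∀ c, 0 ≤ α c) →
      ∏ v, vertexFactor δ (h * Real.sqrt (2 * m / n)) (2 * m / n) (spinDensity σ (-σ v))
          (α (σ v, -σ v)) (α (σ v, σ v)) ≤ β ^ n) :
    expect n m (X d h r) ≤
      Real.exp 1 ^ 4 * (2 * m + 1) ^ 8 * (δ ^ (-(1 - r)) * (2 * β)) ^ n := by
  classical
  have hn' : (0 : ℝ) < n := by exact_mod_cast hn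
  have hcard : (Fintype.card (Multigraph n m) : ℝ) = (n : ℝ) ^ (2 * m) := by
    simp [Multigraph, mul_comm]
  unfold expect
  rw [hcard, div_le_iff₀ (by positivity)]
  have hX : ∀ e : Multigraph n m, (X d h r e : ℝ) ≤ ∑ σ : Config n, (δ ^ (-(1 - r))) ^ n *
      ∏ v, softStep δ (h * Real.sqrt (2 * m / n)) (cutExcess e σ v) := by
    intro e
    have hpos : ∀ σ : Config n, 0 ≤ (δ ^ (-(1 - r))) ^ n *
        ∏ v, softStep δ (h * Real.sqrt (2 * m / n)) (cutExcess e σ v) := fun σ =>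
      mul_nonneg (pow_nonneg (Real.rpow_nonneg hδ.le _) _)
        (Finset.prod_nonneg fun v _ => softStep_nonneg hδ.le _ _)
    unfold X
    rw [Finset.card_filter]
    push_cast
    refine Finset.sum_le_sum fun σ _ => ?_
    split_ifs with hσ
    · exact one_le_rpow_mul_prod_softStep hd hh hδ hδ1 hmd e σ hσ
    · exact hpos σ
  refine (Finset.sum_le_sum fun e _ => hX e).trans ?_
  rw [Finset.sum_comm]
  have hσ : ∀ σ ∈ (Finset.univ : Finset (Config n)), ∑ e : Multigraph n m, (δ ^ (-(1 - r))) ^ n *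
      ∏ v, softStep δ (h * Real.sqrt (2 * m / n)) (cutExcess e σ v) ≤
      (δ ^ (-(1 - r))) ^ n * (Real.exp 1 ^ 4 * (2 * m + 1) ^ 8 * ((n : ℝ) ^ (2 * m) * β ^ n)) := by
    intro σ _
    rw [← Finset.mul_sum]
    exact mul_le_mul_of_nonneg_left (sum_prod_softStep_le hδ.le hn hm σ (hβ σ))
      (pow_nonneg (Real.rpow_nonneg hδ.le _) _)
  refine (Finset.sum_le_card_nsmul _ _ _ hσ).trans_eq ?_
  rw [Finset.card_univ, nsmul_eq_mul]
  simp only [Config, Fintype.card_fun, Fintype.card_units_int, Fintype.card_fin]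
  push_cast
  rw [mul_pow, mul_pow]
  ring

theorem eventually_poly_mul_pow_le {d γ : ℝ} (hd : 0 < d) (hγ : 0 < γ) (hγ1 : γ < 1) :
    ∀ᶠ n : ℕ in atTop, Real.exp 1 ^ 4 * (d * n + 1) ^ 8 * γ ^ n ≤
      Real.exp (-(-Real.log γ / 2) * n) := by
  -- `s` is the square root of `γ`: one factor `s ^ n` absorbs the polynomial, the other is the
  -- bound.
  set s := Real.exp (Real.log γ / 2) with hs
  have hs0 : 0 < s := Real.exp_pos _
  have hs1 : s < 1 := Real.exp_lt_one_iff.2 (by have := Real.log_neg hγ hγ1; linarith)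
  have hss : s * s = γ := by
    rw [hs, ← Real.exp_add, add_halves, Real.exp_log hγ]
  have hlim := (tendsto_pow_const_mul_const_pow_of_abs_lt_one 8
    (by rwa [abs_of_pos hs0] : |s| < 1)).const_mul (Real.exp 1 ^ 4 * (d + 1) ^ 8)
  rw [mul_zero] at hlim
  filter_upwards [hlim.eventually_le_const one_pos, eventually_ge_atTop 1] with n hn hn1
  have hn1' : (1 : ℝ) ≤ n := by exact_mod_cast hn1
  have h1 : (d * n + 1) ^ 8 ≤ ((d + 1) * n) ^ 8 :=
    pow_le_pow_left₀ (by positivity) (by linarith) 8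
  have h2 : Real.exp (-(-Real.log γ / 2) * n) = s ^ n := by
    rw [hs, ← Real.exp_nat_mul]
    congr 1
    ring
  rw [h2, ← hss, mul_pow]
  calc Real.exp 1 ^ 4 * (d * n + 1) ^ 8 * (s ^ n * s ^ n)
      ≤ Real.exp 1 ^ 4 * ((d + 1) * n) ^ 8 * (s ^ n * s ^ n) :=
        mul_le_mul_of_nonneg_right (mul_le_mul_of_nonneg_left h1 (by positivity)) (by positivity)
    _ = Real.exp 1 ^ 4 * (d + 1) ^ 8 * ((n : ℝ) ^ 8 * s ^ n) * s ^ n := by ring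
    _ ≤ 1 * s ^ n := mul_le_mul_of_nonneg_right hn (by positivity)
    _ = s ^ n := one_mul _

/-- The expected number of nearly stable configurations is exponentially small if `w h < 0`. -/
theorem exists_expect_X_le {h : ℝ} (hw : w h < 0) :
    ∃ r : ℝ, 0 < r ∧ r < 1 ∧ ∃ c : ℝ, 0 < c ∧ ∀ᶠ d : ℝ in atTop, ∀ᶠ n : ℕ in atTop,
      0 < n ∧ expect n (numEdges d n) (X d h r) ≤ Real.exp (-c * n) := by
  have hh := pos_of_w_neg hw
  set ϱ := Real.exp (w h) / 2 with hϱ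
  have hϱ0 : 0 < ϱ := by positivity
  have hϱ1 : ϱ < 1 / 2 := by
    have := Real.exp_lt_one_iff.2 hw
    rw [hϱ]
    linarith
  -- Chosen so that `ϱ ^ 2 + 3 * η` is the midpoint of `ϱ ^ 2` and `1 / 4`, which gives `2 * β < 1`.
  set η := (1 / 4 - ϱ ^ 2) / 6 with hη
  have hη0 : 0 < η := by rw [hη]; nlinarith
  have hη1 : η ≤ 1 := by rw [hη]; nlinarith
  set β := Real.sqrt (ϱ ^ 2 + 3 * η) with hβ
  have hβ0 : 0 < β := Real.sqrt_pos.2 (by positivity)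
  have hβ1 : 2 * β < 1 := by
    have : β < 1 / 2 := by
      rw [hβ, Real.sqrt_lt' (by norm_num), hη]
      nlinarith
    linarith
  have hδ0 : 0 < η / 2 := half_pos hη0
  -- At `r = 1` the penalty is `1`, so by continuity some `r < 1` keeps the base below `1`.
  obtain ⟨r, ⟨hr0, hr1⟩, hrγ⟩ : ∃ r : ℝ, r ∈ Set.Ioo (0 : ℝ) 1 ∧
      (η / 2) ^ (-(1 - r)) * (2 * β) < 1 := by
    have hcont : ContinuousAt (fun r : ℝ => (η / 2) ^ (-(1 - r)) * (2 * β)) 1 := by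
      refine ContinuousAt.mul ?_ continuousAt_const
      exact continuousAt_const.rpow (by fun_prop) (Or.inl hδ0.ne')
    have hlim : Tendsto (fun r : ℝ => (η / 2) ^ (-(1 - r)) * (2 * β)) (𝓝[<] 1) (𝓝 (2 * β)) := by
      have := hcont.tendsto
      simp only [sub_self, neg_zero, Real.rpow_zero, one_mul] at this
      exact this.mono_left nhdsWithin_le_nhds
    exact (Filter.Eventually.and (Ioo_mem_nhdsLT one_pos) (hlim.eventually_lt_const hβ1)).exists
  set γ := (η / 2) ^ (-(1 - r)) * (2 * β) with hγ
  have hγ0 : 0 < γ := by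
    have := Real.rpow_pos_of_pos hδ0 (-(1 - r))
    positivity
  refine ⟨r, hr0, hr1, -Real.log γ / 2, ?_, ?_⟩
  · have := Real.log_neg hγ0 hrγ
    linarith
  obtain ⟨D₀, hD₀⟩ := exists_prod_vertexFactor_le hw hη0 hη1
  -- Rounding the number of edges lowers the mean degree `2m/n` by at most `2`, whence `D₀ + 2`; `d
  -- ≥ 2` ensures at least one edge.
  filter_upwards [eventually_ge_atTop (D₀ + 2), eventually_ge_atTop 2] with d hd hd2
  have hdpos : 0 < d := by linarith
  filter_upwards [eventually_poly_mul_pow_le hdpos hγ0 hrγ, eventually_ge_atTop 1] with n hpoly hn1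
  have hn : 0 < n := hn1
  have hn' : (1 : ℝ) ≤ n := by exact_mod_cast hn1
  refine ⟨hn, le_trans ?_ hpoly⟩
  have hdn : 0 ≤ d * n / 2 := by positivity
  set m := numEdges d n with hm
  have hm_le : (m : ℝ) ≤ d * n / 2 := Nat.floor_le hdn
  have hm_lt : d * n / 2 < m + 1 := Nat.lt_floor_add_one _
  have hm0 : 0 < m := by
    rw [hm, numEdges, Nat.floor_pos]
    nlinarith
  have hmd : (2 * m : ℝ) / n ≤ d := by
    rw [div_le_iff₀ (by linarith)]
    linarith
  have hDge : D₀ ≤ (2 * m : ℝ) / n := by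
    rw [le_div_iff₀ (by linarith)]
    nlinarith
  have hDpos : 0 < (2 * m : ℝ) / n := by
    have : (0 : ℝ) < m := by exact_mod_cast hm0
    positivity
  refine (expect_X_le (r := r) (β := β) hn hm0 hdpos hh hδ0 (by linarith) hmd
    fun σ α hα => hD₀ _ hDge hDpos n hn σ α hα).trans ?_
  refine mul_le_mul_of_nonneg_right (mul_le_mul_of_nonneg_left ?_ (by positivity)) (by positivity)
  exact pow_le_pow_left₀ (by positivity) (by linarith) 8

end FirstMoment

end StablePartitions

theorem mainTheorem7 :
    (∃! hstar : ℝ, StablePartitions.w hstar = 0) ∧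
      ∀ hstar : ℝ, StablePartitions.w hstar = 0 →
        ∀ h : ℝ, hstar < h →
          ∃ r : ℝ, 0 < r ∧ r < 1 ∧
            StablePartitions.entropy r h < 0 ∧ StablePartitions.entropyTotal r h < 0 := by
  refine ⟨StablePartitions.existsUnique_w_eq_zero, fun hstar hroot h hh => ?_⟩
  have hw : StablePartitions.w h < 0 := hroot ▸ StablePartitions.strictAnti_w hh
  obtain ⟨r, hr0, hr1, c, hc, hev⟩ := StablePartitions.exists_expect_X_le hw
  have hneg : ((-c : ℝ) : EReal) < 0 := by exact_mod_cast neg_neg_of_pos hc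
  refine ⟨r, hr0, hr1, lt_of_le_of_lt (iSup_le fun x => ?_) hneg, lt_of_le_of_lt ?_ hneg⟩
  · refine limsup_le_of_le (by isBoundedDefault) (hev.mono fun d hd => ?_)
    refine limsup_le_of_le (by isBoundedDefault) (hd.mono fun n hn => ?_)
    exact StablePartitions.rate_le_of_le_exp hn.1
      ((StablePartitions.expect_mono fun e => StablePartitions.Xcut_le_X _ _ _ _ e).trans hn.2)
  · refine limsup_le_of_le (by isBoundedDefault) (hev.mono fun d hd => ?_)
    refine limsup_le_of_le (by isBoundedDefault) (hd.mono fun n hn => ?_)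
    exact StablePartitions.rate_le_of_le_exp hn.1 hn.2
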